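/- **Setting.** Let $h,n_{max}\in\mathbb N$ and $b=2h$. A document is a string $D=D_1\|\dots\|D_m$ of $b$-bit blocks; the documents in use have $1\le m\le n_{max}$ blocks. We work in the random oracle model: $\mathcal R:\{0,1\}^{2b}\to\{0,1\}^{3200}$ is a uniformly random function. The set $\{0,1\}^{3200}$ is identified with $\mathbb Z/2^{3200}\mathbb Z$ by an arbitrary fixed bijection, and $H(M)=\sum_{x\in M}\mathcal R(x)\bmod 2^{3200}$ for a finite multiset $M$ of $2b$-bit strings. Let $\Psi=(G,S,V)$ be a signature scheme for bit strings. The scheme $\mathrm{IncSIG}$ has the key generation $G$. To sign $D$ of $m$ blocks and of bit-size $l$, draw independent uniform $R_1,\dots,R_{m+1}\in\{0,1\}^{b/2}$, put $\mu=\sum_{i=1}^{m}\mathcal R(R_i\|R_{i+1}\|D_i)\bmod 2^{3200}$ and return $(R_1,\dots,R_{m+1},\mu,s)$ with $s=\Psi.S_{sk}(\mu\|l)$. Verification of $(R_1,\dots,R_{m+1},\mu,s)$ for $D$ recomputes the sum $\bar\mu$ and returns $\Psi.V_{pk}(\bar\mu\|l,s)$. An update concerns one block and computes the new $\mu'$ from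 $\mu$ by subtracting the terms of the removed links and adding those of the new ones, and then signs $\mu'\|l'$, $l'$ being the new bit-size: to insert $\sigma$ right after $D_i$, a fresh uniform block $R$ is put between $R_i$ and $R_{i+1}$ and the link $R_i\|R_{i+1}\|D_i$ is replaced by $R_i\|R\|D_i$ and $R\|R_{i+1}\|\sigma$; to delete $D_i$, $R_{i+1}$ is taken out and the links $R_i\|R_{i+1}\|D_i$, $R_{i+1}\|R_{i+2}\|D_{i+1}$ are replaced by $R_i\|R_{i+2}\|D_{i+1}$ (if $D_i$ is the last block, only $R_i\|R_{i+1}\|D_i$ is removed); to replace $D_i$ by $\sigma$, the link $R_i\|R_{i+1}\|D_i$ is replaced by $R_i\|R_{i+1}\|\sigma$. A *$(t,q_i,q_s,\epsilon)$-forger with $q_R$ hash queries* against $\mathrm{IncSIG}$ is a probabilistic algorithm of running time at most $t$ that receives $pk$, makes at most $q_R$ queries to $\mathcal R$, at most $q_s$ queries to a signing oracle for documents in use, and at most $q_i$ queries to an update oracle on signatures issued before by these two oracles (the updated document being in use again), and with probability at least $\epsilon$ outputs a document $D^*$ in use, neither signed nor obtained by an update before, with a signature $S^*=(R_1^*,\dots,R_{m+1}^*,\mu^*,s^*)$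 that is valid for $D^*$ and in which $\mu^*$ is the hash value of $R_1^*\|R_2^*\|D_1^*,\dots,R_m^*\|R_{m+1}^*\|D_m^*$. A *$(t',q',\epsilon')$-collision finder* against $H$ is a probabilistic algorithm of running time at most $t'$ that makes at most $q'$ queries to $\mathcal R$ and with probability at least $\epsilon'$ outputs a set $S$ and a multiset $M\ne S$ of $2b$-bit strings, each with at most $n_{max}$ elements, such that $H(S)=H(M)$. A *$(t'',q'',\epsilon'')$-forger* against $\Psi$ has running time at most $t''$, makes at most $q''$ queries to a signing oracle of $\Psi$ (and has no random oracle), and with probability at least $\epsilon''$ outputs a valid signature for a message that was not queried. Let $t_{op}$ be the time of one addition or subtraction modulo $2^{3200}$, and let $t_{sign}$ be an upper bound on the running times of $\Psi.S$ on messages $\mu\|l$ with $\mu\in\{0,1\}^{3200}$, $l\le n_{max}b$. The running time of an algorithm is the time of its local work plus, for collision finders and forgers against $\Psi$ that run a forger as a subroutine, the time of the executions of $\Psi.S$ and of the additions and subtractions modulo $2^{3200}$ made for it; oracle queries, coin tosses, key generation, storage and comparison of data are not charged. **Theorem.** There are two algorithms $\mathcal{CF}$ and $\mathcal F'$, which run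 a given forger once as a black box (including all its local work) and depend neither on the algorithms of $\Psi$, nor on the bijection $\{0,1\}^{3200}\cong\mathbb Z/2^{3200}\mathbb Z$, nor on the forger (they access $\Psi$ and the addition only by calls), such that the following holds. If $\mathcal F$ is a $(t,q_i,q_s,\epsilon)$-forger with $q_R$ hash queries against $\mathrm{IncSIG}$, then there are $t',t'',\epsilon',\epsilon''$ such that $\mathcal{CF}^{\mathcal F}$ is a $(t',q_R+q_h,\epsilon')$-collision finder against $H$, $\mathcal F'^{\mathcal F}$ is a $(t'',q_s+q_i,\epsilon'')$-forger against $\Psi$, and $$\epsilon\le\frac{q^2-q}{2^{b/2+1}}+\epsilon'+\epsilon'',\qquad t\ge\max\{t'-(q_s+q_i)\,t_{sign},\;t''\}-q_h\,t_{op},$$ where $q=q_s(n_{max}+1)+q_i$ and $q_h=q_sn_{max}+3q_i$. -/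

import Mathlib

noncomputable section

namespace IncSIG

/-! ### Bit strings, documents, the hash function -/

/-- Bit strings of length `n`. -/
abbrev Bits (n : ℕ) : Type := Fin n → Bool

/-- A document is a string over the alphabet of `b`-bit blocks, where `b = 2 * h`. -/
abbrev Doc (h : ℕ) : Type := List (Bits (2 * h))

/-- The documents in use: non-empty, of at most `nmax` blocks. -/
def Doc.Ok {h : ℕ} (nmax : ℕ) (D : Doc h) : Prop := D ≠ [] ∧ D.length ≤ nmax

instance {h : ℕ} (nmax : ℕ) (D : Doc h) : Decidable (Doc.Ok nmax D) := by
  unfold Doc.Ok; infer_instance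

/-- Inputs of the random function: strings of `2 * b = h + (h + 2 * h)` bits. -/
abbrev InBlock (h : ℕ) : Type := Bits (h + (h + 2 * h))

/-- The concatenation `r ‖ r' ‖ d`. -/
def link {h : ℕ} (r r' : Bits h) (d : Bits (2 * h)) : InBlock h :=
  Fin.append r (Fin.append r' d)

/-- Hash values: strings of `ℓ` bits, later `ℓ = 3200`. -/
abbrev Digest (ℓ : ℕ) : Type := Bits ℓ

/-- A representation of the residues modulo `2 ^ ℓ` by `ℓ`-bit strings. -/
abbrev Encoding (ℓ : ℕ) : Type := ZMod (2 ^ ℓ) ≃ Digest ℓ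

/-- Addition modulo `2 ^ ℓ` of hash values. -/
def dAdd {ℓ : ℕ} (enc : Encoding ℓ) (x y : Digest ℓ) : Digest ℓ := enc (enc.symm x + enc.symm y)

/-- Subtraction modulo `2 ^ ℓ` of hash values. -/
def dSub {ℓ : ℕ} (enc : Encoding ℓ) (x y : Digest ℓ) : Digest ℓ := enc (enc.symm x - enc.symm y)

/-- The hash function `H`: the sum modulo `2 ^ ℓ` of the values of the random function `R` at
the blocks of its input. The order of the blocks is irrelevant, only their multiset counts. -/
def hashH {h ℓ : ℕ} (enc : Encoding ℓ) (R : InBlock h → Digest ℓ) (M : Multiset (InBlock h)) :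
    Digest ℓ :=
  enc ((M.map fun x => enc.symm (R x)).sum)

/-- The chained blocks `R₁‖R₂‖D₁, R₂‖R₃‖D₂, …`. -/
def links {h : ℕ} : List (Bits h) → Doc h → List (InBlock h)
  | r :: r' :: rs, d :: ds => link r r' d :: links (r' :: rs) ds
  | _, _ => []

/-! ### Probabilistic algorithms with oracles and their cost -/

/-- Probabilistic algorithms with calls `o : Op` answered in `Ans o`. `step c k` is local work that
takes time `c`, `coins n k` tosses `n` coins. The running time is that of the local work so
declared plus that of the calls (signatures, additions of hash values) which have a cost; coin
tosses, oracle queries, comparisons and storage of data are not charged. -/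
inductive Prog (Op : Type) (Ans : Op → Type) (α : Type) : Type
  | ret (a : α) : Prog Op Ans α
  | step (c : ℕ) (k : Prog Op Ans α) : Prog Op Ans α
  | coins (n : ℕ) (k : Bits n → Prog Op Ans α) : Prog Op Ans α
  | call (o : Op) (k : Ans o → Prog Op Ans α) : Prog Op Ans α

namespace Prog

variable {Op : Type} {Ans : Op → Type} {α β σ : Type}

/-- Sequential composition. -/
def bind : Prog Op Ans α → (α → Prog Op Ans β) → Prog Op Ans β
  | ret a, f => f a
  | step c k, f => step c (bind k f)
  | coins n k, f => coins n fun x => bind (k x) f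
  | call o k, f => call o fun a => bind (k a) f

/-- Execution against an environment with memory `σ` that answers the calls. -/
def run (env : (o : Op) → σ → PMF (Ans o × σ)) : Prog Op Ans α → σ → PMF (α × σ)
  | ret a, s => PMF.pure (a, s)
  | step _ k, s => run env k s
  | coins n k, s => (PMF.uniformOfFintype (Bits n)).bind fun x => run env (k x) s
  | call o k, s => (env o s).bind fun p => run env (k p.1) p.2

/-- Worst-case total weight, over all coin tosses and all answers to calls, when a unit of local
time has weight `u` and a call `o` has weight `w o`. -/
def worst (u : ℕ) (w : Op → ℕ) : Prog Op Ans α → ℕ∞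
  | ret _ => 0
  | step c k => ((u * c : ℕ) : ℕ∞) + worst u w k
  | coins _ k => ⨆ x, worst u w (k x)
  | call o k => ((w o : ℕ) : ℕ∞) + ⨆ a, worst u w (k a)

/-- Worst-case running time, when a call `o` takes time `w o`. -/
def time (w : Op → ℕ) (p : Prog Op Ans α) : ℕ∞ := worst 1 w p

/-- Worst-case number of calls, a call `o` being counted `w o` times. -/
def count (w : Op → ℕ) (p : Prog Op Ans α) : ℕ∞ := worst 0 w p

end Prog

/-! ### The underlying signature scheme -/

/-- A signature scheme `Ψ = (G, S, V)` for bit strings. `signTime sk m` is the worst-case running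
time of `S` on the key `sk` and the message `m`. -/
structure SigScheme (PK SK Sig : Type) where
  gen : PMF (PK × SK)
  sign : SK → List Bool → PMF Sig
  signTime : SK → List Bool → ℕ
  verify : PK → List Bool → Sig → Bool

/-- The string `μ ‖ l`. -/
def message {ℓ : ℕ} (μ : Digest ℓ) (l : ℕ) : List Bool := List.ofFn μ ++ Nat.bits l

/-- Size in bits of a document. -/
def Doc.size {h : ℕ} (D : Doc h) : ℕ := D.length * (2 * h)

/-! ### The incremental signature scheme -/

/-- Incremental signatures `(R₁, …, Rₙ, μ, s)`. -/
structure ISig (h ℓ : ℕ) (Sig : Type) where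
  blocks : List (Bits h)
  digest : Digest ℓ
  sig : Sig

/-- Modifications of one block; positions count from `0`. `insert i σ` inserts `σ` right after the
block at position `i`. -/
inductive Edit (h : ℕ) : Type
  | insert (i : ℕ) (σ : Bits (2 * h))
  | delete (i : ℕ)
  | replace (i : ℕ) (σ : Bits (2 * h))

namespace Edit

variable {h : ℕ}

/-- The position of the block concerned. -/
def pos : Edit h → ℕ
  | insert i _ => i
  | delete i => i
  | replace i _ => i

/-- The modified document. -/
def applyDoc : Edit h → Doc h → Doc h
  | insert i σ, D => D.insertIdx (i + 1) σ
  | delete i, D => D.eraseIdx i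
  | replace i σ, D => D.set i σ

/-- The modified chain of random blocks: an insertion puts the new block `r` between `Rᵢ` and
`Rᵢ₊₁`, the deletion of `Dᵢ` takes `Rᵢ₊₁` out, a replacement keeps the chain. -/
def applyBlocks (r : Bits h) : Edit h → List (Bits h) → List (Bits h)
  | insert i _, rs => rs.insertIdx (i + 1) r
  | delete i, rs => rs.eraseIdx (i + 1)
  | replace _ _, rs => rs

/-- The inputs of the random function whose contribution is removed. A deletion concerns two
links, or one if the last block is deleted. -/
def removed : Edit h → List (Bits h) → Doc h → List (InBlock h)
  | insert i _, rs, D => links ((rs.drop i).take 2) ((D.drop i).take 1)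
  | delete i, rs, D => links ((rs.drop i).take 3) ((D.drop i).take 2)
  | replace i _, rs, D => links ((rs.drop i).take 2) ((D.drop i).take 1)

/-- The inputs of the random function whose contribution is added. For an insertion these are
`Rᵢ‖r‖Dᵢ` and `r‖Rᵢ₊₁‖σ`; for a deletion this is `Rᵢ‖Rᵢ₊₂‖Dᵢ₊₁`, or nothing if the last block is
deleted; for a replacement this is `Rᵢ‖Rᵢ₊₁‖σ`. -/
def added (r : Bits h) : Edit h → List (Bits h) → Doc h → List (InBlock h)
  | insert i σ, rs, D =>
      links (((rs.drop i).take 2).insertIdx 1 r) (((D.drop i).take 1).insertIdx 1 σ)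
  | delete i, rs, D =>
      links (((rs.drop i).take 3).eraseIdx 1) (((D.drop i).take 2).eraseIdx 0)
  | replace i σ, rs, D => links ((rs.drop i).take 2) (((D.drop i).take 1).set 0 σ)

/-- The distribution of the block `r`: fresh for an insertion, not used by the other two. -/
def fresh : Edit h → PMF (Bits h)
  | insert _ _ => PMF.uniformOfFintype (Bits h)
  | delete _ => PMF.pure fun _ => false
  | replace _ _ => PMF.pure fun _ => false

/-- The modification makes sense for `D` and leads to a document in use. -/
def Ok (nmax : ℕ) (e : Edit h) (D : Doc h) : Prop :=
  e.pos < D.length ∧ Doc.Ok nmax (e.applyDoc D)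

instance (nmax : ℕ) (e : Edit h) (D : Doc h) : Decidable (e.Ok nmax D) := by
  unfold Ok; infer_instance

end Edit

/-- `n` independent uniform blocks. -/
def sampleBlocks (h : ℕ) : ℕ → PMF (List (Bits h))
  | 0 => PMF.pure []
  | n + 1 => (PMF.uniformOfFintype (Bits h)).bind fun r =>
      (sampleBlocks h n).bind fun rs => PMF.pure (r :: rs)

section Scheme

variable {h ℓ : ℕ} {PK SK Sig : Type}

/-- The signature algorithm. (Key generation is that of `Ψ`.) -/
def incSign (Ψ : SigScheme PK SK Sig) (enc : Encoding ℓ) (R : InBlock h → Digest ℓ) (sk : SK)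
    (D : Doc h) : PMF (ISig h ℓ Sig) :=
  (sampleBlocks h (D.length + 1)).bind fun rs =>
    let μ := hashH enc R (links rs D)
    (Ψ.sign sk (message μ D.size)).bind fun s => PMF.pure ⟨rs, μ, s⟩

/-- The incremental update algorithm: the new hash value is computed from the old one. -/
def incUpdate (Ψ : SigScheme PK SK Sig) (enc : Encoding ℓ) (R : InBlock h → Digest ℓ) (sk : SK)
    (D : Doc h) (S : ISig h ℓ Sig) (e : Edit h) : PMF (ISig h ℓ Sig) :=
  e.fresh.bind fun r =>
    let μ := dAdd enc (dSub enc S.digest (hashH enc R (e.removed S.blocks D)))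
      (hashH enc R (e.added r S.blocks D))
    (Ψ.sign sk (message μ (e.applyDoc D).size)).bind fun s =>
      PMF.pure ⟨e.applyBlocks r S.blocks, μ, s⟩

/-- The verification algorithm: recompute the hash value, then verify with `Ψ`. -/
def incVerify (Ψ : SigScheme PK SK Sig) (enc : Encoding ℓ) (R : InBlock h → Digest ℓ) (pk : PK)
    (D : Doc h) (S : ISig h ℓ Sig) : Bool :=
  decide (S.blocks.length = D.length + 1) &&
    Ψ.verify pk (message (hashH enc R (links S.blocks D)) D.size) S.sig

end Scheme

/-! ### The unforgeability game of the incremental scheme -/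

/-- Oracle calls of a forger: the random oracle, the signing oracle, and the update oracle on the
signature issued in the `j`-th answer (counted from `0`, over both of the latter oracles). -/
inductive ForgerOp (h : ℕ) : Type
  | ro (x : InBlock h)
  | sign (D : Doc h)
  | update (j : ℕ) (e : Edit h)

/-- Answers to a forger; `none` if the request is refused. -/
def ForgerOp.Ans {h : ℕ} (ℓ : ℕ) (Sig : Type) : ForgerOp h → Type
  | ro _ => Digest ℓ
  | sign _ => Option (ISig h ℓ Sig)
  | update _ _ => Option (ISig h ℓ Sig)

/-- A forger receives a public key and outputs a document with a signature. -/
abbrev Forger (h ℓ : ℕ) (PK Sig : Type) : Type :=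
  PK → Prog (ForgerOp h) (ForgerOp.Ans ℓ Sig) (Doc h × ISig h ℓ Sig)

section Game

variable {h ℓ : ℕ} {PK SK Sig : Type}

/-- The challenger; its memory lists the documents and signatures issued so far. -/
def challenger (nmax : ℕ) (Ψ : SigScheme PK SK Sig) (enc : Encoding ℓ) (R : InBlock h → Digest ℓ)
    (sk : SK) : (o : ForgerOp h) → List (Doc h × ISig h ℓ Sig) →
      PMF (o.Ans ℓ Sig × List (Doc h × ISig h ℓ Sig))
  | .ro x, L => PMF.pure (R x, L)
  | .sign D, L =>
      if Doc.Ok nmax D then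
        (incSign Ψ enc R sk D).bind fun S => PMF.pure (some S, L ++ [(D, S)])
      else PMF.pure (none, L)
  | .update j e, L =>
      match L[j]? with
      | none => PMF.pure (none, L)
      | some (D, S) =>
          if e.Ok nmax D then
            (incUpdate Ψ enc R sk D S e).bind fun S' =>
              PMF.pure (some S', L ++ [(e.applyDoc D, S')])
          else PMF.pure (none, L)

/-- The game, with outcome `true` if the forger wins: its document is new, the signature is valid
and the hash value written in it is the one that the verification computes. -/
def forgeGame (nmax : ℕ) (Ψ : SigScheme PK SK Sig) (enc : Encoding ℓ) (F : Forger h ℓ PK Sig) :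
    PMF Bool :=
  (PMF.uniformOfFintype (InBlock h → Digest ℓ)).bind fun R =>
    Ψ.gen.bind fun k =>
      ((F k.1).run (challenger nmax Ψ enc R k.2) []).bind fun out =>
        PMF.pure (decide (Doc.Ok nmax out.1.1) && decide (out.1.1 ∉ out.2.map Prod.fst) &&
          decide (out.1.2.digest = hashH enc R (links out.1.2.blocks out.1.1)) &&
          incVerify Ψ enc R k.1 out.1.1 out.1.2)

/-- `F` is a `(t, q_i, q_s, ε)`-forger that makes at most `qR` calls to the random oracle. -/
structure IsForger (nmax : ℕ) (Ψ : SigScheme PK SK Sig) (enc : Encoding ℓ) (F : Forger h ℓ PK Sig)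
    (t qR qi qs : ℕ) (ε : ℝ) : Prop where
  time_le : ∀ pk, (F pk).time (fun _ => 0) ≤ t
  ro_le : ∀ pk, (F pk).count (fun | .ro _ => 1 | .sign _ => 0 | .update _ _ => 0) ≤ qR
  sign_le : ∀ pk, (F pk).count (fun | .ro _ => 0 | .sign _ => 1 | .update _ _ => 0) ≤ qs
  update_le : ∀ pk, (F pk).count (fun | .ro _ => 0 | .sign _ => 0 | .update _ _ => 1) ≤ qi
  advantage : ε ≤ (forgeGame nmax Ψ enc F true).toReal

end Game

/-! ### Set-collisions of the hash function -/

/-- Calls of a collision finder: the random oracle, one addition or subtraction of hash values,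
and the key generation and signature algorithms of a signature scheme, run locally. -/
inductive FinderOp (h ℓ : ℕ) (SK : Type) : Type
  | ro (x : InBlock h)
  | add (x y : Digest ℓ)
  | sub (x y : Digest ℓ)
  | gen
  | sign (sk : SK) (m : List Bool)

/-- Results of the calls of a collision finder. -/
def FinderOp.Ans {h ℓ : ℕ} (PK : Type) {SK : Type} (Sig : Type) : FinderOp h ℓ SK → Type
  | ro _ => Digest ℓ
  | add _ _ => Digest ℓ
  | sub _ _ => Digest ℓ
  | gen => PK × SK
  | sign _ _ => Sig

/-- A collision finder outputs a set and a multiset of blocks. -/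
abbrev Finder (h ℓ : ℕ) (PK SK Sig : Type) : Type :=
  Prog (FinderOp h ℓ SK) (FinderOp.Ans PK Sig) (Finset (InBlock h) × Multiset (InBlock h))

section Collision

variable {h ℓ : ℕ} {PK SK Sig : Type}

/-- The environment of a collision finder. -/
def finderEnv (Ψ : SigScheme PK SK Sig) (enc : Encoding ℓ) (R : InBlock h → Digest ℓ) :
    (o : FinderOp h ℓ SK) → Unit → PMF (o.Ans PK Sig × Unit)
  | .ro x, _ => PMF.pure (R x, ())
  | .add x y, _ => PMF.pure (dAdd enc x y, ())
  | .sub x y, _ => PMF.pure (dSub enc x y, ())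
  | .gen, _ => Ψ.gen.bind fun k => PMF.pure (k, ())
  | .sign sk m, _ => (Ψ.sign sk m).bind fun s => PMF.pure (s, ())

/-- The game, with outcome `true` if the finder outputs a set-collision: a set and a multiset
that are different, of at most `N` elements each, and have the same hash value. -/
def collisionGame (N : ℕ) (Ψ : SigScheme PK SK Sig) (enc : Encoding ℓ) (A : Finder h ℓ PK SK Sig) :
    PMF Bool :=
  (PMF.uniformOfFintype (InBlock h → Digest ℓ)).bind fun R =>
    (A.run (finderEnv Ψ enc R) ()).bind fun out =>
      PMF.pure (decide (out.1.1.card ≤ N) && decide (out.1.2.card ≤ N) &&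
        decide (out.1.1.val ≠ out.1.2) &&
        decide (hashH enc R out.1.1.val = hashH enc R out.1.2))

/-- Time charged for the calls of a collision finder. -/
def FinderOp.cost (Ψ : SigScheme PK SK Sig) (tOp : ℕ) : FinderOp h ℓ SK → ℕ
  | ro _ => 0
  | add _ _ => tOp
  | sub _ _ => tOp
  | gen => 0
  | sign sk m => Ψ.signTime sk m

/-- `A` is a `(t, q, ε)`-finder of set-collisions of size at most `N`. -/
structure IsCollisionFinder (N : ℕ) (Ψ : SigScheme PK SK Sig) (enc : Encoding ℓ) (tOp : ℕ)
    (A : Finder h ℓ PK SK Sig) (t q : ℕ) (ε : ℝ) : Prop where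
  time_le : A.time (FinderOp.cost Ψ tOp) ≤ t
  ro_le : A.count
    (fun | .ro _ => 1 | .add _ _ => 0 | .sub _ _ => 0 | .gen => 0 | .sign _ _ => 0) ≤ q
  advantage : ε ≤ (collisionGame N Ψ enc A true).toReal

end Collision

/-! ### Forgeries of the underlying signature scheme -/

/-- Calls of a forger against the signature scheme: its signing oracle, and one addition or
subtraction of hash values. It has no access to a random oracle. -/
inductive SigForgerOp (ℓ : ℕ) : Type
  | add (x y : Digest ℓ)
  | sub (x y : Digest ℓ)
  | sign (m : List Bool)

/-- Results of the calls of a forger against the signature scheme. -/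
def SigForgerOp.Ans {ℓ : ℕ} (Sig : Type) : SigForgerOp ℓ → Type
  | add _ _ => Digest ℓ
  | sub _ _ => Digest ℓ
  | sign _ => Sig

/-- A forger against the signature scheme outputs a message with a signature. -/
abbrev SigForger (ℓ : ℕ) (PK Sig : Type) : Type :=
  PK → Prog (SigForgerOp ℓ) (SigForgerOp.Ans Sig) (List Bool × Sig)

section SigGame

variable {ℓ : ℕ} {PK SK Sig : Type}

/-- The challenger; its memory lists the messages signed so far. -/
def sigChallenger (Ψ : SigScheme PK SK Sig) (enc : Encoding ℓ) (sk : SK) :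
    (o : SigForgerOp ℓ) → List (List Bool) → PMF (o.Ans Sig × List (List Bool))
  | .add x y, L => PMF.pure (dAdd enc x y, L)
  | .sub x y, L => PMF.pure (dSub enc x y, L)
  | .sign m, L => (Ψ.sign sk m).bind fun s => PMF.pure (s, L ++ [m])

/-- Existential unforgeability under chosen message attacks. -/
def sigGame (Ψ : SigScheme PK SK Sig) (enc : Encoding ℓ) (A : SigForger ℓ PK Sig) : PMF Bool :=
  Ψ.gen.bind fun k =>
    ((A k.1).run (sigChallenger Ψ enc k.2) []).bind fun out =>
      PMF.pure (decide (out.1.1 ∉ out.2) && Ψ.verify k.1 out.1.1 out.1.2)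

/-- Time charged for the calls of a forger against the signature scheme. -/
def SigForgerOp.cost {ℓ : ℕ} (tOp : ℕ) : SigForgerOp ℓ → ℕ
  | add _ _ => tOp
  | sub _ _ => tOp
  | sign _ => 0

/-- `A` is a `(t, q, ε)`-forger against `Ψ`. -/
structure IsSigForger (Ψ : SigScheme PK SK Sig) (enc : Encoding ℓ) (tOp : ℕ) (A : SigForger ℓ PK Sig)
    (t q : ℕ) (ε : ℝ) : Prop where
  time_le : ∀ pk, (A pk).time (SigForgerOp.cost tOp) ≤ t
  sign_le : ∀ pk, (A pk).count (fun | .add _ _ => 0 | .sub _ _ => 0 | .sign _ => 1) ≤ q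
  advantage : ε ≤ (sigGame Ψ enc A true).toReal

end SigGame

/-! ### Using a forger as a subroutine -/

/-- An algorithm that, on an input in `In`, runs a forger once as a black box: it hands a public
key to the forger, answers its calls, and computes its own output in `Out` from that of the
forger. -/
structure Reduction (h ℓ : ℕ) (PK Sig : Type) (Op : Type) (Ans : Op → Type) (In Out : Type) where
  State : Type
  init : In → Prog Op Ans (PK × State)
  answer : (o : ForgerOp h) → State → Prog Op Ans (o.Ans ℓ Sig × State)
  finish : Doc h × ISig h ℓ Sig → State → Prog Op Ans Out

namespace Reduction

variable {h ℓ : ℕ} {PK Sig : Type} {Op : Type} {Ans : Op → Type} {In Out : Type}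

/-- Execution of the forger. Its local work and its coin tosses are those of the whole. -/
def simulate (C : Reduction h ℓ PK Sig Op Ans In Out) {α : Type} :
    Prog (ForgerOp h) (ForgerOp.Ans ℓ Sig) α → C.State → Prog Op Ans (α × C.State)
  | .ret a, s => .ret (a, s)
  | .step c k, s => .step c (C.simulate k s)
  | .coins n k, s => .coins n fun x => C.simulate (k x) s
  | .call o k, s => (C.answer o s).bind fun p => C.simulate (k p.1) p.2

/-- The algorithm obtained by plugging in the forger `F`. -/
def plug (C : Reduction h ℓ PK Sig Op Ans In Out) (F : Forger h ℓ PK Sig) (x : In) :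
    Prog Op Ans Out :=
  (C.init x).bind fun p => (C.simulate (F p.1) p.2).bind fun q => C.finish q.1 q.2

end Reduction

end IncSIG

end

noncomputable section

namespace IncSIG

/-! ### Sequential composition and interpretation of programs -/

namespace Prog

variable {Op Op' : Type} {Ans : Op → Type} {Ans' : Op' → Type} {α β σ τ : Type}

/-- Replace every call of a program by a program that shares a memory `τ`. -/
def interp (I : (o : Op) → τ → Prog Op' Ans' (Ans o × τ)) :
    Prog Op Ans α → τ → Prog Op' Ans' (α × τ)
  | ret a, t => ret (a, t)
  | step c k, t => step c (interp I k t)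
  | coins n k, t => coins n fun x => interp I (k x) t
  | call o k, t => (I o t).bind fun p => interp I (k p.1) p.2

theorem bind_assoc {γ : Type} (p : Prog Op Ans α) (f : α → Prog Op Ans β)
    (g : β → Prog Op Ans γ) : (p.bind f).bind g = p.bind fun a => (f a).bind g := by
  induction p with
  | ret a => rfl
  | step c k ih => simp [bind, ih]
  | coins n k ih => simp [bind, ih]
  | call o k ih => simp [bind, ih]

theorem interp_bind (I : (o : Op) → τ → Prog Op' Ans' (Ans o × τ)) (p : Prog Op Ans α)
    (f : α → Prog Op Ans β) (t : τ) :
    interp I (p.bind f) t = (interp I p t).bind fun x => interp I (f x.1) x.2 := by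
  induction p generalizing t with
  | ret a => rfl
  | step c k ih => simp [bind, interp, ih]
  | coins n k ih => simp [bind, interp, ih]
  | call o k ih => simp [bind, interp, ih, bind_assoc]

theorem run_bind (env : (o : Op) → σ → PMF (Ans o × σ)) (p : Prog Op Ans α)
    (f : α → Prog Op Ans β) (s : σ) :
    run env (p.bind f) s = (run env p s).bind fun x => run env (f x.1) x.2 := by
  induction p generalizing s with
  | ret a => simp [bind, run]
  | step c k ih => simp [bind, run, ih]
  | coins n k ih => simp [bind, run, ih]
  | call o k ih => simp [bind, run, ih]

/-! ### Worst-case weights -/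

theorem worst_bind_le (u : ℕ) (w : Op → ℕ) (p : Prog Op Ans α) (f : α → Prog Op Ans β) (c : ℕ∞)
    (hf : ∀ a, worst u w (f a) ≤ c) : worst u w (p.bind f) ≤ worst u w p + c := by
  induction p with
  | ret a => simpa [bind, worst] using hf a
  | step n k ih => simp only [bind, worst, add_assoc]; gcongr
  | coins n k ih =>
    exact iSup_le fun x => (ih x).trans (by gcongr; exact le_iSup (fun x => worst u w (k x)) x)
  | call o k ih =>
    simp only [bind, worst, add_assoc]
    gcongr
    exact iSup_le fun x => (ih x).trans (by gcongr; exact le_iSup (fun x => worst u w (k x)) x)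

theorem worst_bind_ret (u : ℕ) (w : Op → ℕ) (p : Prog Op Ans α) (f : α → β) :
    worst u w (p.bind fun a => ret (f a)) = worst u w p := by
  induction p with
  | ret a => rfl
  | step n k ih => simp [bind, worst, ih]
  | coins n k ih => simp [bind, worst, ih]
  | call o k ih => simp [bind, worst, ih]

theorem worst_call_ret (u : ℕ) (w : Op → ℕ) (o : Op) (f : Ans o → α) :
    worst u w (call o fun a => ret (f a)) = w o := by
  simp [worst]

theorem worst_interp_le (u : ℕ) (w : Op → ℕ) (w' : Op' → ℕ)
    (I : (o : Op) → τ → Prog Op' Ans' (Ans o × τ))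
    (hI : ∀ o t, worst u w' (I o t) ≤ (w o : ℕ∞)) (p : Prog Op Ans α) (t : τ) :
    worst u w' (interp I p t) ≤ worst u w p := by
  induction p generalizing t with
  | ret a => simp [interp, worst]
  | step n k ih => simp only [interp, worst]; gcongr; exact ih t
  | coins n k ih => exact iSup_mono fun x => ih x t
  | call o k ih =>
    refine (worst_bind_le u w' _ _ (⨆ a, worst u w (k a)) fun a => ?_).trans ?_
    · exact (ih a.1 a.2).trans (le_iSup (fun x => worst u w (k x)) a.1)
    · simp only [worst]; gcongr; exact hI o t

theorem worst_add_le (u v : ℕ) (w w' : Op → ℕ) (p : Prog Op Ans α) :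
    worst (u + v) (fun o => w o + w' o) p ≤ worst u w p + worst v w' p := by
  induction p with
  | ret a => simp [worst]
  | step n k ih =>
    simp only [worst, add_mul, Nat.cast_add]
    rw [add_add_add_comm]
    gcongr
  | coins n k ih =>
    exact iSup_le fun x => (ih x).trans
      (add_le_add (le_iSup (fun x => worst u w (k x)) x) (le_iSup (fun x => worst v w' (k x)) x))
  | call o k ih =>
    simp only [worst, Nat.cast_add]
    rw [add_add_add_comm]
    gcongr
    exact iSup_le fun x => (ih x).trans
      (add_le_add (le_iSup (fun x => worst u w (k x)) x) (le_iSup (fun x => worst v w' (k x)) x))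

theorem worst_mul_le (c u : ℕ) (w : Op → ℕ) (p : Prog Op Ans α) :
    worst (c * u) (fun o => c * w o) p ≤ c * worst u w p := by
  induction p with
  | ret a => simp [worst]
  | step n k ih =>
    simp only [worst, mul_add, mul_assoc, Nat.cast_mul] at *
    gcongr
  | coins n k ih =>
    exact iSup_le fun x => (ih x).trans (by gcongr; exact le_iSup (fun x => worst u w (k x)) x)
  | call o k ih =>
    simp only [worst, mul_add, Nat.cast_mul]
    gcongr
    exact iSup_le fun x => (ih x).trans (by gcongr; exact le_iSup (fun x => worst u w (k x)) x)

theorem worst_mono (u : ℕ) {w w' : Op → ℕ} (h : ∀ o, w o ≤ w' o) (p : Prog Op Ans α) :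
    worst u w p ≤ worst u w' p := by
  induction p with
  | ret a => rfl
  | step n k ih => simp only [worst]; gcongr
  | coins n k ih => exact iSup_mono ih
  | call o k ih => simp only [worst]; gcongr with a; exacts [h o, ih a]

/-! ### Executions of interpreted programs -/

theorem run_interp (I : (o : Op) → τ → Prog Op' Ans' (Ans o × τ))
    (env' : (o : Op') → σ → PMF (Ans' o × σ)) {χ : Type} (env : (o : Op) → χ → PMF (Ans o × χ))
    (f : χ → τ) (g : χ → σ)
    (h : ∀ o x, run env' (I o (f x)) (g x) =
      (env o x).bind fun y => PMF.pure ((y.1, f y.2), g y.2))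
    (p : Prog Op Ans α) (x : χ) :
    run env' (interp I p (f x)) (g x) =
      (run env p x).bind fun y => PMF.pure ((y.1, f y.2), g y.2) := by
  induction p generalizing x with
  | ret a => simp [interp, run]
  | step n k ih => simp [interp, run, ih]
  | coins n k ih => simp [interp, run, ih]
  | call o k ih => simp [interp, run, run_bind, h, ih]

theorem run_eq_run_interp (I : (o : Op) → τ → Prog Op' Ans' (Ans o × τ))
    (env' : (o : Op') → σ → PMF (Ans' o × σ)) {χ : Type} (env : (o : Op) → χ → PMF (Ans o × χ))
    (f : τ → χ)
    (h : ∀ o t s, env o (f t) = (run env' (I o t) s).bind fun y => PMF.pure (y.1.1, f y.1.2))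
    (p : Prog Op Ans α) (t : τ) (s : σ) :
    run env p (f t) =
      (run env' (interp I p t) s).bind fun y => PMF.pure (y.1.1, f y.1.2) := by
  induction p generalizing t s with
  | ret a => simp [interp, run]
  | step n k ih => simp [interp, run, ← ih]
  | coins n k ih => simp [interp, run, ← ih]
  | call o k ih => simp [interp, run, run_bind, ← ih, h o t s]

theorem run_interp_invariant (I : (o : Op) → τ → Prog Op' Ans' (Ans o × τ))
    (env' : (o : Op') → σ → PMF (Ans' o × σ)) (Inv : τ → σ → Prop)
    (h : ∀ o t s, Inv t s → ∀ y ∈ (run env' (I o t) s).support, Inv y.1.2 y.2)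
    (p : Prog Op Ans α) (t : τ) (s : σ) (hts : Inv t s) :
    ∀ y ∈ (run env' (interp I p t) s).support, Inv y.1.2 y.2 := by
  induction p generalizing t s with
  | ret a => intro y hy; simp [interp, run] at hy; subst hy; exact hts
  | step n k ih => exact ih t s hts
  | coins n k ih =>
    intro y hy
    simp only [interp, run, PMF.mem_support_bind_iff] at hy
    obtain ⟨x, -, hy⟩ := hy
    exact ih x t s hts y hy
  | call o k ih =>
    intro y hy
    simp only [interp, run_bind, PMF.mem_support_bind_iff] at hy
    obtain ⟨x, hx, hy⟩ := hy
    exact ih x.1.1 x.1.2 x.2 (h o t s hts x hx) y hy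

end Prog

/-! ### Chained blocks -/

section Links

variable {h : ℕ}

theorem link_inj {r r' s s' : Bits h} {d e : Bits (2 * h)} (H : link r r' d = link s s' e) :
    r = s ∧ r' = s' ∧ d = e := by
  refine ⟨funext fun i => ?_, funext fun i => ?_, funext fun i => ?_⟩
  · simpa [link] using congrFun H (Fin.castAdd _ i)
  · simpa [link] using congrFun H (Fin.natAdd _ (Fin.castAdd _ i))
  · simpa [link] using congrFun H (Fin.natAdd _ (Fin.natAdd _ i))

theorem length_links_le (rs : List (Bits h)) (D : Doc h) : (links rs D).length ≤ D.length := by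
  induction rs, D using links.induct with
  | case1 r r' rs d ds ih => simpa [links] using ih
  | case2 rs D hne => rw [links]; simp; exact hne

theorem length_links (rs : List (Bits h)) (D : Doc h) (hl : rs.length = D.length + 1) :
    (links rs D).length = D.length := by
  induction rs, D using links.induct with
  | case1 r r' rs d ds ih => simpa [links] using ih (by simpa using hl)
  | case2 rs D hne =>
    match rs, D, hl with
    | [r], [], _ => simp [links]
    | r :: r' :: rs, d :: ds, _ => exact (hne _ _ _ _ _ rfl rfl).elim

theorem mem_links {rs : List (Bits h)} {D : Doc h} {x : InBlock h} :
    x ∈ links rs D ↔ ∃ k r r' d, rs[k]? = some r ∧ rs[k + 1]? = some r' ∧ D[k]? = some d ∧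
      x = link r r' d := by
  induction rs, D using links.induct with
  | case1 r r' rs d ds ih =>
    rw [links, List.mem_cons, ih]
    constructor
    · rintro (rfl | ⟨k, s, s', e, h1, h2, h3, rfl⟩)
      · exact ⟨0, r, r', d, by simp⟩
      · exact ⟨k + 1, s, s', e, by simpa using h1, by simpa using h2, by simpa using h3, rfl⟩
    · rintro ⟨k, s, s', e, h1, h2, h3, rfl⟩
      cases k with
      | zero => simp at h1 h2 h3; subst h1 h2 h3; exact Or.inl rfl
      | succ k =>
        exact Or.inr ⟨k, s, s', e, by simpa using h1, by simpa using h2, by simpa using h3, rfl⟩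
  | case2 rs D hne =>
    rw [links]
    · constructor
      · simp
      · rintro ⟨k, s, s', e, h1, h2, h3, rfl⟩
        match rs, D, k, h1, h2, h3 with
        | r :: r' :: rs, d :: ds, _, _, _, _ => exact (hne _ _ _ _ _ rfl rfl).elim
        | [r], d :: ds, k, h1, h2, h3 => simp at h2
    · exact hne

theorem nodup_links {rs : List (Bits h)} (hrs : rs.Nodup) (D : Doc h) : (links rs D).Nodup := by
  induction rs, D using links.induct with
  | case1 r r' rs d ds ih =>
    rw [links, List.nodup_cons]
    refine ⟨fun hmem => ?_, ih hrs.of_cons⟩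
    obtain ⟨k, s, s', e, h1, -, -, hx⟩ := mem_links.1 hmem
    obtain ⟨rfl, -, -⟩ := link_inj hx
    exact (List.nodup_cons.1 hrs).1 (List.mem_of_getElem? h1)
  | case2 rs D hne => rw [links]; simp; exact hne

/-- A chain without repeated blocks is determined by its links, and so is the document. -/
theorem doc_eq_of_links {rs rs' : List (Bits h)} {D D' : Doc h} (hrs : rs.Nodup)
    (hl' : rs'.length = D'.length + 1) (hD : D.length = D'.length)
    (hsub : ∀ x ∈ links rs' D', x ∈ links rs D) : D = D' := by
  have key : ∀ j < D'.length, ∃ k, rs'[j]? = rs[k]? ∧ rs'[j + 1]? = rs[k + 1]? ∧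
      D'[j]? = D[k]? ∧ k + 1 < rs.length ∧ k < D.length := by
    intro j hj
    have hmem : link rs'[j] rs'[j + 1] D'[j] ∈ links rs' D' :=
      mem_links.2 ⟨j, rs'[j], rs'[j + 1], D'[j], by simp, by simp, by simp, rfl⟩
    obtain ⟨k, s, s', e, h1, h2, h3, hx⟩ := mem_links.1 (hsub _ hmem)
    obtain ⟨e1, e2, e3⟩ := link_inj hx
    refine ⟨k, ?_, ?_, ?_, ?_, ?_⟩
    · rw [h1, ← e1]; simp
    · rw [h2, ← e2]; simp
    · rw [h3, ← e3]; simp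
    · exact (List.getElem?_eq_some_iff.1 h2).1
    · exact (List.getElem?_eq_some_iff.1 h3).1
  rcases Nat.eq_zero_or_pos D'.length with h0 | hpos
  · rw [List.length_eq_zero_iff.1 h0, List.length_eq_zero_iff.1 (hD.trans h0)]
  obtain ⟨k, -, hk1, hk2, hk3, hk4⟩ := key 0 hpos
  have all : ∀ j < D'.length, rs'[j + 1]? = rs[k + j + 1]? ∧ D'[j]? = D[k + j]? ∧
      k + j < D.length := by
    intro j
    induction j with
    | zero => intro _; exact ⟨hk1, hk2, hk4⟩
    | succ j ih =>
      intro hj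
      obtain ⟨i1, i2, i3⟩ := ih (by omega)
      obtain ⟨m, h1, h2, h3, h4, h5⟩ := key (j + 1) hj
      have hm : m = k + j + 1 := 
        (List.getElem?_inj (l := rs) (by omega) hrs).1 (by rw [← h1, i1])
      subst hm
      exact ⟨h2, h3, h5⟩
  have hk : k = 0 := by
    have := (all (D'.length - 1) (by omega)).2.2
    omega
  subst hk
  refine (List.ext_getElem? fun j => ?_).symm
  by_cases hj : j < D'.length
  · simpa using (all j hj).2.1
  · rw [List.getElem?_eq_none (by omega), List.getElem?_eq_none (by omega)]

end Links

/-! ### Modifications -/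

namespace Edit

variable {h : ℕ}

theorem length_applyBlocks (r : Bits h) (e : Edit h) (rs : List (Bits h)) (D : Doc h)
    (hl : rs.length = D.length + 1) (hi : e.pos < D.length) :
    (e.applyBlocks r rs).length = (e.applyDoc D).length + 1 := by
  cases e with
  | insert i σ =>
    simp only [pos] at hi
    simp only [applyBlocks, applyDoc]
    rw [List.length_insertIdx_of_le_length (by omega), List.length_insertIdx_of_le_length (by omega)]
    omega
  | delete i =>
    simp only [pos] at hi
    simp only [applyBlocks, applyDoc]
    rw [List.length_eraseIdx_of_lt (by omega), List.length_eraseIdx_of_lt (by omega)]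
    omega
  | replace i σ => simpa [applyBlocks, applyDoc] using hl

theorem length_removed_add_added (r : Bits h) (e : Edit h) (rs : List (Bits h)) (D : Doc h) :
    (e.removed rs D).length + (e.added r rs D).length ≤ 3 := by
  cases e with
  | insert i σ =>
    have h1 := length_links_le ((rs.drop i).take 2) ((D.drop i).take 1)
    have h2 := length_links_le (((rs.drop i).take 2).insertIdx 1 r)
      (((D.drop i).take 1).insertIdx 1 σ)
    have h3 := List.length_insertIdx_le_succ (l := (D.drop i).take 1) (x := σ) (i := 1)
    have h4 := List.length_take_le 1 (D.drop i)
    simp only [removed, added]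
    omega
  | delete i =>
    have h1 := length_links_le ((rs.drop i).take 3) ((D.drop i).take 2)
    have h2 := length_links_le (((rs.drop i).take 3).eraseIdx 1) (((D.drop i).take 2).eraseIdx 0)
    have h4 := List.length_take_le 2 (D.drop i)
    have h3 : (((D.drop i).take 2).eraseIdx 0).length ≤ 1 := by
      simp
    simp only [removed, added]
    omega
  | replace i σ =>
    have h1 := length_links_le ((rs.drop i).take 2) ((D.drop i).take 1)
    have h2 := length_links_le ((rs.drop i).take 2) (((D.drop i).take 1).set 0 σ)
    have h4 := List.length_take_le 1 (D.drop i)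
    simp only [removed, added, List.length_set] at *
    omega

theorem links_apply (r : Bits h) (e : Edit h) (rs : List (Bits h)) (D : Doc h)
    (hl : rs.length = D.length + 1) (hi : e.pos < D.length) :
    (links (e.applyBlocks r rs) (e.applyDoc D) : Multiset (InBlock h)) + (e.removed rs D : Multiset _)
      = (links rs D : Multiset _) + (e.added r rs D : Multiset _) := by
  rw [Multiset.coe_add, Multiset.coe_add, Multiset.coe_eq_coe]
  cases e with
  | insert i σ =>
    simp only [pos, applyBlocks, applyDoc, removed, added] at *
    induction i generalizing rs D with
    | zero =>
      match rs, D, hl, hi with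
      | [r0], D, hl, hi => simp at hl; simp [hl] at hi
      | r0 :: r1 :: rs, d :: ds, _, _ =>
        refine List.perm_iff_count.2 fun x => ?_
        simp [links, List.count_cons]
        omega
    | succ i ih =>
      match rs, D, hl, hi with
      | [r0], D, hl, hi => simp at hl; simp [hl] at hi
      | r0 :: r1 :: rs, d :: ds, hl, hi =>
        simpa [links] using ih (r1 :: rs) ds (by simpa using hl) (by simpa using hi)
  | delete i =>
    simp only [pos, applyBlocks, applyDoc, removed, added] at *
    induction i generalizing rs D with
    | zero =>
      match rs, D, hl, hi with
      | [r0], D, hl, hi => simp at hl; simp [hl] at hi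
      | [r0, r1], [d], _, _ => simp [links]
      | r0 :: r1 :: r2 :: rs, d :: d' :: ds, _, _ =>
        refine List.perm_iff_count.2 fun x => ?_
        simp [links, List.count_cons]
        omega
    | succ i ih =>
      match rs, D, hl, hi with
      | [r0], D, hl, hi => simp at hl; simp [hl] at hi
      | r0 :: r1 :: rs, d :: ds, hl, hi =>
        simpa [links] using ih (r1 :: rs) ds (by simpa using hl) (by simpa using hi)
  | replace i σ =>
    simp only [pos, applyBlocks, applyDoc, removed, added] at *
    induction i generalizing rs D with
    | zero =>
      match rs, D, hl, hi with
      | [r0], D, hl, hi => simp at hl; simp [hl] at hi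
      | r0 :: r1 :: rs, d :: ds, _, _ =>
        refine List.perm_iff_count.2 fun x => ?_
        simp [links, List.count_cons]
        omega
    | succ i ih =>
      match rs, D, hl, hi with
      | [r0], D, hl, hi => simp at hl; simp [hl] at hi
      | r0 :: r1 :: rs, d :: ds, hl, hi =>
        simpa [links] using ih (r1 :: rs) ds (by simpa using hl) (by simpa using hi)

end Edit

/-! ### Simulation of the challenger -/

/-- Calls made to simulate the challenger of the incremental scheme: the random function, additions
and subtractions of hash values, signatures of `Ψ`, and random blocks. -/
inductive SimOp (h ℓ : ℕ) : Type
  | ro (x : InBlock h)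
  | add (x y : Digest ℓ)
  | sub (x y : Digest ℓ)
  | sign (m : List Bool)
  | draw

/-- Results of the calls of a simulation. -/
def SimOp.Ans {h ℓ : ℕ} (Sig : Type) : SimOp h ℓ → Type
  | ro _ => Digest ℓ
  | add _ _ => Digest ℓ
  | sub _ _ => Digest ℓ
  | sign _ => Sig
  | draw => Bits h

/-- A weight function on the calls of a simulation. -/
def SimOp.weight {h ℓ : ℕ} (r a : ℕ) (s : List Bool → ℕ) (d : ℕ) : SimOp h ℓ → ℕ
  | ro _ => r
  | add _ _ => a
  | sub _ _ => a
  | sign m => s m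
  | draw => d

/-- A weight function on the calls of a forger. -/
def ForgerOp.weight {h : ℕ} (r s u : ℕ) : ForgerOp h → ℕ
  | ro _ => r
  | sign _ => s
  | update _ _ => u

section Simulation

variable {h ℓ : ℕ} {PK SK Sig : Type}

/-- Programs with the calls of a simulation. -/
abbrev Sim (h ℓ : ℕ) (Sig α : Type) : Type := Prog (SimOp h ℓ) (SimOp.Ans Sig) α

/-- Draw `n` random blocks. -/
def drawBlocks : ℕ → Sim h ℓ Sig (List (Bits h))
  | 0 => .ret []
  | n + 1 => .call .draw fun r => (drawBlocks n).bind fun rs => .ret (r :: rs)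

/-- Add the values of the random function at the listed inputs. -/
def addHashes : List (InBlock h) → Digest ℓ → Sim h ℓ Sig (Digest ℓ)
  | [], μ => .ret μ
  | x :: xs, μ => .call (.ro x) fun y => .call (.add μ y) fun z => addHashes xs z

/-- Subtract the values of the random function at the listed inputs. -/
def subHashes : List (InBlock h) → Digest ℓ → Sim h ℓ Sig (Digest ℓ)
  | [], μ => .ret μ
  | x :: xs, μ => .call (.ro x) fun y => .call (.sub μ y) fun z => subHashes xs z

/-- The hash value of a list of inputs. -/
def sumHashes : List (InBlock h) → Sim h ℓ Sig (Digest ℓ)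
  | [] => .call (.sub (fun _ => false) (fun _ => false)) .ret
  | x :: xs => .call (.ro x) fun y => addHashes xs y

/-- Draw the random block of a modification. -/
def drawFresh : Edit h → Sim h ℓ Sig (Bits h)
  | .insert _ _ => .call .draw .ret
  | .delete _ => .ret fun _ => false
  | .replace _ _ => .ret fun _ => false

/-- The answers of the challenger, computed with calls of a simulation. -/
def answer (nmax : ℕ) : (o : ForgerOp h) → List (Doc h × ISig h ℓ Sig) →
    Sim h ℓ Sig (o.Ans ℓ Sig × List (Doc h × ISig h ℓ Sig))
  | .ro x, L => .call (.ro x) fun y => .ret (y, L)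
  | .sign D, L =>
      if Doc.Ok nmax D then
        (drawBlocks (D.length + 1)).bind fun rs =>
          (sumHashes (links rs D)).bind fun μ =>
            .call (.sign (message μ D.size)) fun s =>
              .ret (some ⟨rs, μ, s⟩, L ++ [(D, ⟨rs, μ, s⟩)])
      else .ret (none, L)
  | .update j e, L =>
      match L[j]? with
      | none => .ret (none, L)
      | some (D, S) =>
          if e.Ok nmax D then
            (drawFresh e).bind fun r =>
              (subHashes (e.removed S.blocks D) S.digest).bind fun ν =>
                (addHashes (e.added r S.blocks D) ν).bind fun μ =>
                  .call (.sign (message μ (e.applyDoc D).size)) fun s =>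
                    .ret (some ⟨e.applyBlocks r S.blocks, μ, s⟩,
                      L ++ [(e.applyDoc D, ⟨e.applyBlocks r S.blocks, μ, s⟩)])
          else .ret (none, L)

/-! ### Cost of the simulation -/

section Cost

variable (u r a : ℕ) (s : List Bool → ℕ) (d : ℕ)

theorem worst_drawBlocks (n : ℕ) :
    Prog.worst u (SimOp.weight r a s d) (drawBlocks n : Sim h ℓ Sig _) ≤ (n * d : ℕ) := by
  induction n with
  | zero => simp [drawBlocks, Prog.worst]
  | succ n ih =>
    simp only [drawBlocks, Prog.worst, Prog.worst_bind_ret, SimOp.weight]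
    rw [add_mul, one_mul, add_comm (n * d), Nat.cast_add]
    gcongr
    exact iSup_le fun x => ih

theorem worst_addHashes (xs : List (InBlock h)) (μ : Digest ℓ) :
    Prog.worst u (SimOp.weight r a s d) (addHashes xs μ : Sim h ℓ Sig _) ≤
      (xs.length * (r + a) : ℕ) := by
  induction xs generalizing μ with
  | nil => simp [addHashes, Prog.worst]
  | cons x xs ih =>
    simp only [addHashes, Prog.worst, SimOp.weight, List.length_cons]
    rw [add_mul, one_mul, add_comm (_ * _), add_assoc, Nat.cast_add, Nat.cast_add]
    gcongr
    refine iSup_le fun x => ?_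
    gcongr
    exact iSup_le fun x => ih x

theorem worst_subHashes (xs : List (InBlock h)) (μ : Digest ℓ) :
    Prog.worst u (SimOp.weight r a s d) (subHashes xs μ : Sim h ℓ Sig _) ≤
      (xs.length * (r + a) : ℕ) := by
  induction xs generalizing μ with
  | nil => simp [subHashes, Prog.worst]
  | cons x xs ih =>
    simp only [subHashes, Prog.worst, SimOp.weight, List.length_cons]
    rw [add_mul, one_mul, add_comm (_ * _), add_assoc, Nat.cast_add, Nat.cast_add]
    gcongr
    refine iSup_le fun x => ?_
    gcongr
    exact iSup_le fun x => ih x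

theorem worst_sumHashes (xs : List (InBlock h)) {n : ℕ} (hn : 0 < n) (hxs : xs.length ≤ n) :
    Prog.worst u (SimOp.weight r a s d) (sumHashes xs : Sim h ℓ Sig _) ≤ (n * (r + a) : ℕ) := by
  cases xs with
  | nil =>
    refine (Prog.worst_call_ret _ _ _ _).trans_le (Nat.cast_le.2 ?_)
    simp only [SimOp.weight]
    nlinarith
  | cons x xs =>
    simp only [sumHashes, Prog.worst, SimOp.weight]
    calc _ ≤ (r : ℕ∞) + ((xs.length * (r + a) : ℕ) : ℕ∞) := by
          gcongr; exact iSup_le fun y => worst_addHashes u r a s d xs y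
      _ ≤ _ := by
          rw [← Nat.cast_add, Nat.cast_le]
          simp only [List.length_cons] at hxs
          nlinarith

theorem worst_drawFresh (e : Edit h) :
    Prog.worst u (SimOp.weight r a s d) (drawFresh e : Sim h ℓ Sig _) ≤ d := by
  cases e <;> simp [drawFresh, Prog.worst, SimOp.weight]

theorem worst_answer (nmax c : ℕ)
    (hs : ∀ (μ : Digest ℓ) (l : ℕ), l ≤ nmax * (2 * h) → s (message μ l) ≤ c)
    (o : ForgerOp h) (L : List (Doc h × ISig h ℓ Sig)) :
    Prog.worst u (SimOp.weight r a s d) (answer nmax o L) ≤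
      (ForgerOp.weight r ((nmax + 1) * d + nmax * (r + a) + c) (d + 3 * (r + a) + c) o : ℕ) := by
  cases o with
  | ro x => simp [answer, Prog.worst, ForgerOp.weight, SimOp.weight]
  | sign D =>
    simp only [answer, ForgerOp.weight]
    split_ifs with hD
    · rw [add_assoc, Nat.cast_add, Nat.cast_add]
      refine (Prog.worst_bind_le _ _ _ _ ((nmax * (r + a) : ℕ) + (c : ℕ∞)) fun rs => ?_).trans ?_
      · refine (Prog.worst_bind_le _ _ _ _ (c : ℕ∞) fun μ => ?_).trans ?_
        · refine (Prog.worst_call_ret _ _ _ _).trans_le (Nat.cast_le.2 ?_)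
          exact hs _ _ (Nat.mul_le_mul_right _ hD.2)
        · gcongr
          exact worst_sumHashes u r a s d _
            ((List.length_pos_iff.2 hD.1).trans_le hD.2) ((length_links_le _ _).trans hD.2)
      · gcongr
        refine (worst_drawBlocks u r a s d _).trans ?_
        gcongr
        exact hD.2
    · simp [Prog.worst]
  | update j e =>
    simp only [answer, ForgerOp.weight]
    split
    · simp [Prog.worst]
    · rename_i D S _
      split_ifs with hD
      · rw [add_assoc, Nat.cast_add, Nat.cast_add]
        refine (Prog.worst_bind_le _ _ _ _ ((3 * (r + a) : ℕ) + (c : ℕ∞)) fun x => ?_).trans ?_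
        · refine (Prog.worst_bind_le _ _ _ _
            (((e.added x S.blocks D).length * (r + a) : ℕ) + (c : ℕ∞)) fun ν => ?_).trans ?_
          · refine (Prog.worst_bind_le _ _ _ _ (c : ℕ∞) fun μ => ?_).trans ?_
            · refine (Prog.worst_call_ret _ _ _ _).trans_le (Nat.cast_le.2 ?_)
              exact hs _ _ (Nat.mul_le_mul_right _ hD.2.2)
            · gcongr
              exact worst_addHashes u r a s d _ _
          · rw [← add_assoc]
            gcongr
            refine (add_le_add_left (worst_subHashes u r a s d _ _) _).trans ?_
            rw [← Nat.cast_add, Nat.cast_le, ← add_mul]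
            gcongr
            exact e.length_removed_add_added x S.blocks D
        · gcongr
          exact worst_drawFresh u r a s d e
      · simp [Prog.worst]

end Cost

end Simulation

section SimulationRun

variable {h ℓ : ℕ} {PK SK Sig : Type}

/-- The environment of a simulation; its memory lists the messages signed and the blocks drawn. -/
def simEnv (Ψ : SigScheme PK SK Sig) (enc : Encoding ℓ) (R : InBlock h → Digest ℓ) (sk : SK) :
    (o : SimOp h ℓ) → List (List Bool) × List (Bits h) →
      PMF (o.Ans Sig × (List (List Bool) × List (Bits h)))
  | .ro x, s => PMF.pure (R x, s)
  | .add x y, s => PMF.pure (dAdd enc x y, s)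
  | .sub x y, s => PMF.pure (dSub enc x y, s)
  | .sign m, s => (Ψ.sign sk m).bind fun g => PMF.pure (g, (s.1 ++ [m], s.2))
  | .draw, s => (PMF.uniformOfFintype (Bits h)).bind fun r => PMF.pure (r, (s.1, s.2 ++ [r]))

/-! ### Arithmetic of hash values -/

theorem dAdd_hashH_cons (enc : Encoding ℓ) (R : InBlock h → Digest ℓ) (μ : Digest ℓ) (x : InBlock h)
    (xs : List (InBlock h)) :
    dAdd enc (dAdd enc μ (R x)) (hashH enc R xs) =
      dAdd enc μ (hashH enc R ((x :: xs : List _) : Multiset _)) := by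
  simp [dAdd, hashH, add_assoc]

theorem dSub_hashH_cons (enc : Encoding ℓ) (R : InBlock h → Digest ℓ) (μ : Digest ℓ) (x : InBlock h)
    (xs : List (InBlock h)) :
    dSub enc (dSub enc μ (R x)) (hashH enc R xs) =
      dSub enc μ (hashH enc R ((x :: xs : List _) : Multiset _)) := by
  simp [dSub, hashH, sub_sub]

theorem dAdd_dSub_hashH (enc : Encoding ℓ) (R : InBlock h → Digest ℓ)
    {M N A B : Multiset (InBlock h)} (H : M + A = N + B) :
    dAdd enc (dSub enc (hashH enc R N) (hashH enc R A)) (hashH enc R B) = hashH enc R M := by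
  have H' := congrArg (fun X => (X.map fun x => enc.symm (R x)).sum) H
  simp only [Multiset.map_add, Multiset.sum_add] at H'
  simp only [dAdd, dSub, hashH, Equiv.symm_apply_apply, EmbeddingLike.apply_eq_iff_eq]
  rw [sub_add_eq_add_sub, ← H', add_sub_cancel_right]

/-! ### The answers of the simulation -/

variable (Ψ : SigScheme PK SK Sig) (enc : Encoding ℓ) (R : InBlock h → Digest ℓ) (sk : SK)

theorem run_drawBlocks (n : ℕ) (s : List (List Bool) × List (Bits h)) :
    (drawBlocks n : Sim h ℓ Sig _).run (simEnv Ψ enc R sk) s =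
      (sampleBlocks h n).bind fun rs => PMF.pure (rs, (s.1, s.2 ++ rs)) := by
  induction n generalizing s with
  | zero => simp [drawBlocks, Prog.run, sampleBlocks]
  | succ n ih => simp [drawBlocks, Prog.run, sampleBlocks, simEnv, Prog.run_bind, ih]

theorem run_addHashes (xs : List (InBlock h)) (μ : Digest ℓ)
    (s : List (List Bool) × List (Bits h)) :
    (addHashes xs μ : Sim h ℓ Sig _).run (simEnv Ψ enc R sk) s =
      PMF.pure (dAdd enc μ (hashH enc R xs), s) := by
  induction xs generalizing μ with
  | nil => simp [addHashes, Prog.run, dAdd, hashH]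
  | cons x xs ih =>
    simp only [addHashes, Prog.run, simEnv, PMF.pure_bind, ih, dAdd_hashH_cons]

theorem run_subHashes (xs : List (InBlock h)) (μ : Digest ℓ)
    (s : List (List Bool) × List (Bits h)) :
    (subHashes xs μ : Sim h ℓ Sig _).run (simEnv Ψ enc R sk) s =
      PMF.pure (dSub enc μ (hashH enc R xs), s) := by
  induction xs generalizing μ with
  | nil => simp [subHashes, Prog.run, dSub, hashH]
  | cons x xs ih =>
    simp only [subHashes, Prog.run, simEnv, PMF.pure_bind, ih, dSub_hashH_cons]

theorem run_sumHashes (xs : List (InBlock h)) (s : List (List Bool) × List (Bits h)) :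
    (sumHashes xs : Sim h ℓ Sig _).run (simEnv Ψ enc R sk) s =
      PMF.pure (hashH enc R xs, s) := by
  cases xs with
  | nil => simp [sumHashes, Prog.run, simEnv, dSub, hashH]
  | cons x xs =>
    simp [sumHashes, Prog.run, simEnv, run_addHashes, dAdd, hashH]

/-- The blocks drawn for a modification. -/
def Edit.drawn (r : Bits h) : Edit h → List (Bits h)
  | .insert _ _ => [r]
  | .delete _ => []
  | .replace _ _ => []

theorem run_drawFresh (e : Edit h) (s : List (List Bool) × List (Bits h)) :
    (drawFresh e : Sim h ℓ Sig _).run (simEnv Ψ enc R sk) s =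
      e.fresh.bind fun r => PMF.pure (r, (s.1, s.2 ++ e.drawn r)) := by
  cases e <;> simp [drawFresh, Prog.run, simEnv, Edit.fresh, Edit.drawn]

theorem run_answer_sign (nmax : ℕ) (D : Doc h) (hD : Doc.Ok nmax D)
    (L : List (Doc h × ISig h ℓ Sig)) (s : List (List Bool) × List (Bits h)) :
    (answer nmax (.sign D) L).run (simEnv Ψ enc R sk) s =
      (sampleBlocks h (D.length + 1)).bind fun rs =>
        (Ψ.sign sk (message (hashH enc R (links rs D)) D.size)).bind fun g =>
          PMF.pure ((some ⟨rs, hashH enc R (links rs D), g⟩,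
            L ++ [(D, ⟨rs, hashH enc R (links rs D), g⟩)]),
            (s.1 ++ [message (hashH enc R (links rs D)) D.size], s.2 ++ rs)) := by
  simp only [answer, if_pos hD, Prog.run_bind, run_drawBlocks, run_sumHashes, Prog.run, simEnv,
    PMF.bind_bind, PMF.pure_bind]
  rfl

theorem run_answer_update (nmax j : ℕ) (e : Edit h) (D : Doc h) (S : ISig h ℓ Sig)
    (L : List (Doc h × ISig h ℓ Sig)) (hj : L[j]? = some (D, S)) (he : e.Ok nmax D)
    (s : List (List Bool) × List (Bits h)) :
    (answer nmax (.update j e) L).run (simEnv Ψ enc R sk) s =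
      e.fresh.bind fun r =>
        let μ := dAdd enc (dSub enc S.digest (hashH enc R (e.removed S.blocks D)))
          (hashH enc R (e.added r S.blocks D))
        (Ψ.sign sk (message μ (e.applyDoc D).size)).bind fun g =>
          PMF.pure ((some ⟨e.applyBlocks r S.blocks, μ, g⟩,
            L ++ [(e.applyDoc D, ⟨e.applyBlocks r S.blocks, μ, g⟩)]),
            (s.1 ++ [message μ (e.applyDoc D).size], s.2 ++ e.drawn r)) := by
  simp only [answer, hj, if_pos he, Prog.run_bind, run_drawFresh, run_subHashes, run_addHashes,
    Prog.run, simEnv, PMF.bind_bind, PMF.pure_bind]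
  rfl

/-- The simulated answers have the distribution of the answers of the challenger. -/
theorem challenger_eq (nmax : ℕ) (o : ForgerOp h) (L : List (Doc h × ISig h ℓ Sig))
    (s : List (List Bool) × List (Bits h)) :
    challenger nmax Ψ enc R sk o L =
      ((answer nmax o L).run (simEnv Ψ enc R sk) s).bind fun y => PMF.pure (y.1.1, y.1.2) := by
  cases o with
  | ro x => simp only [challenger, answer, Prog.run, simEnv, PMF.pure_bind]
  | sign D =>
    by_cases hD : Doc.Ok nmax D
    · rw [run_answer_sign _ _ _ _ _ _ hD]
      simp only [challenger, if_pos hD, incSign, PMF.bind_bind, PMF.pure_bind]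
      refine Eq.trans ?_ (PMF.bind_bind _ _ _).symm
      refine congrArg _ (funext fun r => ?_)
      refine Eq.trans ?_ (PMF.bind_bind _ _ _).symm
      refine congrArg _ (funext fun g => ?_)
      refine Eq.trans ?_ (PMF.pure_bind _ _).symm
      rfl
    · simp only [challenger, answer, if_neg hD, Prog.run, PMF.pure_bind]
  | update j e =>
    rcases hj : L[j]? with _ | ⟨D, S⟩
    · simp only [challenger, answer, hj, Prog.run, PMF.pure_bind]
    · by_cases he : e.Ok nmax D
      · rw [run_answer_update _ _ _ _ _ _ _ _ _ _ hj he]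
        simp only [challenger, hj, if_pos he, incUpdate, PMF.bind_bind, PMF.pure_bind]
        refine Eq.trans ?_ (PMF.bind_bind _ _ _).symm
        refine congrArg _ (funext fun r => ?_)
        refine Eq.trans ?_ (PMF.bind_bind _ _ _).symm
        refine congrArg _ (funext fun g => ?_)
        refine Eq.trans ?_ (PMF.pure_bind _ _).symm
        rfl
      · simp only [challenger, answer, hj, if_neg he, Prog.run, PMF.pure_bind]

theorem length_of_mem_sampleBlocks {n : ℕ} {rs : List (Bits h)}
    (hrs : rs ∈ (sampleBlocks h n).support) : rs.length = n := by
  induction n generalizing rs with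
  | zero => simp [sampleBlocks] at hrs; simp [hrs]
  | succ n ih =>
    simp only [sampleBlocks, PMF.mem_support_bind_iff] at hrs
    obtain ⟨r, -, rs', hrs', hrs⟩ := hrs
    simp at hrs
    simp [hrs, ih hrs']

/-- What holds for the documents and signatures issued, and for the memory of `simEnv`. -/
structure Issued (nmax : ℕ) (enc : Encoding ℓ) (R : InBlock h → Digest ℓ)
    (L : List (Doc h × ISig h ℓ Sig)) (s : List (List Bool) × List (Bits h)) : Prop where
  messages : s.1 = L.map fun x => message x.2.digest x.1.size
  ok : ∀ x ∈ L, Doc.Ok nmax x.1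
  length : ∀ x ∈ L, x.2.blocks.length = x.1.length + 1
  digest : ∀ x ∈ L, x.2.digest = hashH enc R (links x.2.blocks x.1)
  nodup : s.2.Nodup → ∀ x ∈ L, x.2.blocks.Nodup ∧ x.2.blocks ⊆ s.2

theorem Issued.append {nmax : ℕ} {L : List (Doc h × ISig h ℓ Sig)}
    {s : List (List Bool) × List (Bits h)} (H : Issued nmax enc R L s) (D : Doc h)
    (S : ISig h ℓ Sig) (B : List (Bits h)) (hD : Doc.Ok nmax D)
    (hl : S.blocks.length = D.length + 1) (hμ : S.digest = hashH enc R (links S.blocks D))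
    (hB : (s.2 ++ B).Nodup → S.blocks.Nodup ∧ S.blocks ⊆ s.2 ++ B) :
    Issued nmax enc R (L ++ [(D, S)]) (s.1 ++ [message S.digest D.size], s.2 ++ B) where
  messages := by simp [H.messages]
  ok := by
    simp only [List.mem_append, List.mem_singleton]
    rintro x (hx | rfl)
    exacts [H.ok x hx, hD]
  length := by
    simp only [List.mem_append, List.mem_singleton]
    rintro x (hx | rfl)
    exacts [H.length x hx, hl]
  digest := by
    simp only [List.mem_append, List.mem_singleton]
    rintro x (hx | rfl)
    exacts [H.digest x hx, hμ]
  nodup := by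
    intro hnd
    simp only [List.mem_append, List.mem_singleton]
    rintro x (hx | rfl)
    · obtain ⟨h1, h2⟩ := H.nodup (List.nodup_append.1 hnd).1 x hx
      exact ⟨h1, List.subset_append_of_subset_left _ h2⟩
    · exact hB hnd

theorem Edit.applyBlocks_nodup (r : Bits h) (e : Edit h) {rs B : List (Bits h)} {D : Doc h}
    (hl : rs.length = D.length + 1) (hi : e.pos < D.length) (hrs : rs.Nodup) (hsub : rs ⊆ B)
    (hB : (B ++ e.drawn r).Nodup) :
    (e.applyBlocks r rs).Nodup ∧ e.applyBlocks r rs ⊆ B ++ e.drawn r := by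
  cases e with
  | insert i σ =>
    simp only [Edit.applyBlocks, Edit.drawn, Edit.pos] at *
    have hp : (rs.insertIdx (i + 1) r).Perm (r :: rs) := List.perm_insertIdx _ _ (by omega)
    have hr : r ∉ B := by
      intro hr
      exact (List.nodup_append.1 hB).2.2 r hr r (by simp) rfl
    refine ⟨hp.nodup_iff.2 (List.nodup_cons.2 ⟨fun hx => hr (hsub hx), hrs⟩), fun x hx => ?_⟩
    rcases List.mem_cons.1 (hp.mem_iff.1 hx) with rfl | hx
    · simp
    · exact List.mem_append_left _ (hsub hx)
  | delete i =>
    simp only [Edit.applyBlocks, Edit.drawn, List.append_nil]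
    exact ⟨hrs.sublist (List.eraseIdx_sublist ..), fun x hx => hsub (List.mem_of_mem_eraseIdx hx)⟩
  | replace i σ => simpa [Edit.applyBlocks, Edit.drawn] using ⟨hrs, hsub⟩

theorem issued_answer (nmax : ℕ) (o : ForgerOp h) (L : List (Doc h × ISig h ℓ Sig))
    (s : List (List Bool) × List (Bits h)) (H : Issued nmax enc R L s) :
    ∀ y ∈ ((answer nmax o L).run (simEnv Ψ enc R sk) s).support,
      Issued nmax enc R y.1.2 y.2 := by
  intro y hy
  cases o with
  | ro x =>
    simp only [answer, Prog.run, simEnv, PMF.pure_bind, PMF.mem_support_pure_iff] at hy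
    subst hy; exact H
  | sign D =>
    by_cases hD : Doc.Ok nmax D
    · rw [run_answer_sign _ _ _ _ _ _ hD] at hy
      obtain ⟨rs, hrs, hy⟩ := (PMF.mem_support_bind_iff _ _ _).1 hy
      obtain ⟨g, -, hy⟩ := (PMF.mem_support_bind_iff _ _ _).1 hy
      obtain rfl := (PMF.mem_support_pure_iff _ _).1 hy
      exact H.append enc R D ⟨rs, hashH enc R (links rs D), g⟩ rs hD
        (length_of_mem_sampleBlocks hrs) rfl
        fun hnd => ⟨(List.nodup_append.1 hnd).2.1, List.subset_append_right _ _⟩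
    · simp only [answer, if_neg hD, Prog.run, PMF.mem_support_pure_iff] at hy
      subst hy; exact H
  | update j e =>
    rcases hj : L[j]? with _ | ⟨D, S⟩
    · simp only [answer, hj, Prog.run, PMF.mem_support_pure_iff] at hy
      subst hy; exact H
    · by_cases he : e.Ok nmax D
      · rw [run_answer_update _ _ _ _ _ _ _ _ _ _ hj he] at hy
        obtain ⟨r, -, hy⟩ := (PMF.mem_support_bind_iff _ _ _).1 hy
        obtain ⟨g, -, hy⟩ := (PMF.mem_support_bind_iff _ _ _).1 hy
        obtain rfl := (PMF.mem_support_pure_iff _ _).1 hy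
        have hm := List.mem_of_getElem? hj
        have hl := H.length _ hm
        refine H.append enc R (e.applyDoc D) ⟨e.applyBlocks r S.blocks, _, g⟩ (e.drawn r) he.2
          (e.length_applyBlocks r _ _ hl he.1) ?_ fun hnd => ?_
        · rw [H.digest _ hm]
          exact dAdd_dSub_hashH enc R (e.links_apply r _ _ hl he.1)
        · obtain ⟨h1, h2⟩ := H.nodup (List.nodup_append.1 hnd).1 _ hm
          exact e.applyBlocks_nodup r hl he.1 h1 h2 hnd
      · simp only [answer, hj, if_neg he, Prog.run, PMF.mem_support_pure_iff] at hy
        subst hy; exact H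

/-! ### Repetitions among the blocks drawn -/

theorem toOuterMeasure_bind_le {α β : Type} (p : PMF α) (f : α → PMF β) (E : Set β) (c : ENNReal)
    (hc : ∀ a, (f a).toOuterMeasure E ≤ c) : (p.bind f).toOuterMeasure E ≤ c := by
  rw [PMF.toOuterMeasure_bind_apply]
  calc _ ≤ ∑' a, p a * c := ENNReal.tsum_le_tsum fun a => by gcongr; exact hc a
    _ = c := by rw [ENNReal.tsum_mul_right, p.tsum_coe, one_mul]

theorem toOuterMeasure_le_one {α : Type} (p : PMF α) (E : Set α) : p.toOuterMeasure E ≤ 1 := by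
  calc _ ≤ p.toOuterMeasure Set.univ := p.toOuterMeasure.mono (Set.subset_univ _)
    _ = 1 := (p.toOuterMeasure_apply_eq_one_iff _).2 (Set.subset_univ _)

theorem sum_ite_mem_le {α : Type} [Fintype α] [DecidableEq α] (B : List α) :
    ∑ r : α, (if r ∈ B then (1 : ENNReal) else 0) ≤ B.length := by
  rw [Finset.sum_boole]
  have : (Finset.univ.filter fun r => r ∈ B) = B.toFinset := by ext; simp
  rw [this]
  exact_mod_cast B.toFinset_card_le

theorem birthday {α : Type} (p : Sim h ℓ Sig α) (n : ℕ) (s : List (List Bool) × List (Bits h))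
    (hp : p.worst 0 (SimOp.weight 0 0 (fun _ => 0) 1) ≤ n) (hs : s.2.Nodup) :
    (p.run (simEnv Ψ enc R sk) s).toOuterMeasure {y | ¬ y.2.2.Nodup} ≤
      ((∑ j ∈ Finset.range n, (s.2.length + j) : ℕ) : ENNReal) * (2 ^ h)⁻¹ := by
  induction p generalizing n s with
  | ret a => simp [Prog.run, hs]
  | step c k ih =>
    simp only [Prog.worst, zero_mul, Nat.cast_zero, zero_add] at hp
    exact ih n s hp hs
  | coins m k ih =>
    exact toOuterMeasure_bind_le _ _ _ _ fun x =>
      ih x n s ((le_iSup (fun x => Prog.worst _ _ (k x)) x).trans hp) hs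
  | call o k ih =>
    have hk : ∀ (m : ℕ), (⨆ a, Prog.worst 0 (SimOp.weight 0 0 (fun _ => 0) 1) (k a)) ≤ (m : ℕ∞) →
        ∀ a, Prog.worst 0 (SimOp.weight 0 0 (fun _ => 0) 1) (k a) ≤ (m : ℕ∞) :=
      fun m hm a => (le_iSup (fun x => Prog.worst _ _ (k x)) a).trans hm
    simp only [Prog.worst] at hp
    cases o with
    | ro x =>
      simp only [SimOp.weight, Nat.cast_zero, zero_add] at hp
      simpa only [Prog.run, simEnv, PMF.pure_bind] using ih _ n s (hk n hp _) hs
    | add x y =>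
      simp only [SimOp.weight, Nat.cast_zero, zero_add] at hp
      simpa only [Prog.run, simEnv, PMF.pure_bind] using ih _ n s (hk n hp _) hs
    | sub x y =>
      simp only [SimOp.weight, Nat.cast_zero, zero_add] at hp
      simpa only [Prog.run, simEnv, PMF.pure_bind] using ih _ n s (hk n hp _) hs
    | sign m =>
      simp only [SimOp.weight, Nat.cast_zero, zero_add] at hp
      simp only [Prog.run, simEnv, PMF.bind_bind, PMF.pure_bind]
      exact toOuterMeasure_bind_le _ _ _ _ fun g => ih g n (_, s.2) (hk n hp g) hs
    | draw =>
      simp only [SimOp.weight, Nat.cast_one] at hp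
      obtain ⟨n, rfl⟩ : ∃ m, n = m + 1 := by
        refine ⟨n - 1, (Nat.sub_add_cancel ?_).symm⟩
        exact_mod_cast le_self_add.trans hp
      have hp' : (⨆ a, Prog.worst 0 (SimOp.weight 0 0 (fun _ => 0) 1) (k a)) ≤ (n : ℕ∞) := by
        rw [add_comm, Nat.cast_add, Nat.cast_one] at hp
        exact (ENat.add_le_add_iff_right ENat.one_ne_top).1 hp
      simp only [Prog.run, simEnv, PMF.bind_bind, PMF.pure_bind]
      rw [PMF.toOuterMeasure_bind_apply, tsum_fintype]
      set c : ENNReal := ((∑ j ∈ Finset.range n, (s.2.length + 1 + j) : ℕ) : ENNReal) * (2 ^ h)⁻¹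
        with hc
      have hcard : ((Fintype.card (Bits h) : ℕ) : ENNReal) = 2 ^ h := by simp
      have hb : ∀ r : Bits h, ((k r).run (simEnv Ψ enc R sk) (s.1, s.2 ++ [r])).toOuterMeasure
          {y | ¬ y.2.2.Nodup} ≤ (if r ∈ s.2 then 1 else 0) + c := by
        intro r
        split_ifs with hr
        · exact (toOuterMeasure_le_one _ _).trans le_self_add
        · rw [zero_add]
          refine (ih r n (s.1, s.2 ++ [r]) (hk n hp' r) ?_).trans_eq (by simp [hc])
          exact List.nodup_append.2 ⟨hs, by simp, by
            rintro a ha b hb rfl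
            simp at hb
            exact hr (hb ▸ ha)⟩
      calc _ ≤ ∑ r : Bits h, (2 ^ h : ENNReal)⁻¹ * ((if r ∈ s.2 then 1 else 0) + c) := by
            refine Finset.sum_le_sum fun r _ => ?_
            rw [PMF.uniformOfFintype_apply, hcard]
            gcongr
            exact hb r
        _ = (2 ^ h : ENNReal)⁻¹ * (∑ r : Bits h, if r ∈ s.2 then 1 else 0) + c := by
            rw [← Finset.mul_sum, Finset.sum_add_distrib, mul_add, Finset.sum_const,
              Finset.card_univ, nsmul_eq_mul, hcard, ← mul_assoc,
              ENNReal.inv_mul_cancel (by positivity) (by simp), one_mul]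
        _ ≤ (2 ^ h : ENNReal)⁻¹ * s.2.length + c := by
            gcongr
            exact sum_ite_mem_le s.2
        _ = _ := by
            rw [hc, mul_comm, ← add_mul, Finset.sum_range_succ', ← Nat.cast_add]
            congr 2
            rw [add_zero, add_comm]
            congr 1
            exact Finset.sum_congr rfl fun j _ => by ring

end SimulationRun

section Reductions

variable {h ℓ : ℕ} {PK SK Sig : Type}

/-- The reduction that answers a forger by `answer`, makes the calls of `answer` as prescribed by
`I`, and computes its output from that of the forger and the documents and signatures issued. -/
def simReduction (nmax : ℕ) {Op : Type} {Ans : Op → Type} {τ In Out : Type}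
    (I : (o : SimOp h ℓ) → τ → Prog Op Ans (o.Ans Sig × τ)) (init : In → Prog Op Ans (PK × τ))
    (finish : Doc h × ISig h ℓ Sig → List (Doc h × ISig h ℓ Sig) → Out) :
    Reduction h ℓ PK Sig Op Ans In Out where
  State := τ × List (Doc h × ISig h ℓ Sig)
  init x := (init x).bind fun p => .ret (p.1, (p.2, []))
  answer o s := ((answer nmax o s.2).interp I s.1).bind fun y => .ret (y.1.1, (y.2, y.1.2))
  finish out s := .ret (finish out s.2)

theorem simulate_simReduction (nmax : ℕ) {Op : Type} {Ans : Op → Type} {τ In Out α : Type}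
    (I : (o : SimOp h ℓ) → τ → Prog Op Ans (o.Ans Sig × τ)) (init : In → Prog Op Ans (PK × τ))
    (finish : Doc h × ISig h ℓ Sig → List (Doc h × ISig h ℓ Sig) → Out)
    (p : Prog (ForgerOp h) (ForgerOp.Ans ℓ Sig) α) (t : τ) (L : List (Doc h × ISig h ℓ Sig)) :
    (simReduction nmax I init finish).simulate p (t, L) =
      ((p.interp (answer nmax) L).interp I t).bind fun y => .ret (y.1.1, (y.2, y.1.2)) := by
  induction p generalizing t L with
  | ret a => rfl
  | step c k ih => exact congrArg _ (ih t L)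
  | coins n k ih => exact congrArg _ (funext fun x => ih x t L)
  | call o k ih =>
    simp only [Reduction.simulate, Prog.interp, Prog.interp_bind, Prog.bind_assoc]
    refine (Prog.bind_assoc _ _ _).trans (congrArg _ (funext fun y => ?_))
    exact ih _ _ _

theorem plug_simReduction (nmax : ℕ) {Op : Type} {Ans : Op → Type} {τ In Out : Type}
    (I : (o : SimOp h ℓ) → τ → Prog Op Ans (o.Ans Sig × τ)) (init : In → Prog Op Ans (PK × τ))
    (finish : Doc h × ISig h ℓ Sig → List (Doc h × ISig h ℓ Sig) → Out) (F : Forger h ℓ PK Sig)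
    (x : In) :
    (simReduction nmax I init finish).plug F x = (init x).bind fun p =>
      (((F p.1).interp (answer nmax) []).interp I p.2).bind fun y =>
        .ret (finish y.1.1 y.1.2) := by
  refine (Prog.bind_assoc _ _ _).trans (congrArg _ (funext fun p => ?_))
  refine (congrArg (fun q => Prog.bind q _)
    (simulate_simReduction nmax I init finish (F p.1) p.2 [])).trans ?_
  exact Prog.bind_assoc _ _ _

/-! ### The collision finder -/

/-- How the collision finder makes the calls of the simulation; it holds the secret key. -/
def finderHandler : (o : SimOp h ℓ) → SK →
    Prog (FinderOp h ℓ SK) (FinderOp.Ans PK Sig) (o.Ans Sig × SK)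
  | .ro x, sk => .call (.ro x) fun y => .ret (y, sk)
  | .add x y, sk => .call (.add x y) fun z => .ret (z, sk)
  | .sub x y, sk => .call (.sub x y) fun z => .ret (z, sk)
  | .sign m, sk => .call (.sign sk m) fun g => .ret (g, sk)
  | .draw, sk => .coins h fun r => .ret (r, sk)

/-- The links of a signature issued together with those of the forgery, if they collide. -/
def findCollision (out : Doc h × ISig h ℓ Sig) (L : List (Doc h × ISig h ℓ Sig)) :
    Finset (InBlock h) × Multiset (InBlock h) :=
  match L.find? fun x => decide (x.2.digest = out.2.digest ∧ (links x.2.blocks x.1).Nodup ∧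
      (links x.2.blocks x.1 : Multiset (InBlock h)) ≠ links out.2.blocks out.1) with
  | some x => ((links x.2.blocks x.1).toFinset, links out.2.blocks out.1)
  | none => (∅, 0)

/-- The collision finder. -/
def collisionReduction (h ℓ nmax : ℕ) (PK SK Sig : Type) :
    Reduction h ℓ PK Sig (FinderOp h ℓ SK) (FinderOp.Ans PK Sig) Unit
      (Finset (InBlock h) × Multiset (InBlock h)) :=
  simReduction nmax finderHandler (fun _ => .call .gen fun k => .ret k) findCollision

theorem plug_collisionReduction (nmax : ℕ) (F : Forger h ℓ PK Sig) :
    (collisionReduction h ℓ nmax PK SK Sig).plug F () = .call .gen fun k =>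
      (((F k.1).interp (answer nmax) []).interp finderHandler k.2).bind fun y =>
        .ret (findCollision y.1.1 y.1.2) :=
  plug_simReduction ..

/-- The weight of a call of the simulation when it is made by the collision finder. -/
def finderWeight (w : FinderOp h ℓ SK → ℕ) (sk : SK) : SimOp h ℓ → ℕ
  | .ro x => w (.ro x)
  | .add x y => w (.add x y)
  | .sub x y => w (.sub x y)
  | .sign m => w (.sign sk m)
  | .draw => 0

theorem worst_interp_finderHandler {α : Type} (u : ℕ) (w : FinderOp h ℓ SK → ℕ) (p : Sim h ℓ Sig α)
    (sk : SK) :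
    (p.interp (finderHandler (PK := PK)) sk).worst u w = p.worst u (finderWeight w sk) := by
  induction p with
  | ret a => rfl
  | step c k ih => exact congrArg _ ih
  | coins n k ih => exact congrArg _ (funext ih)
  | call o k ih =>
    cases o with
    | draw => exact (congrArg _ (funext ih)).trans (by simp [Prog.worst, finderWeight]; rfl)
    | _ => exact congrArg _ (congrArg _ (funext ih))

theorem run_interp_finderHandler {α : Type} (Ψ : SigScheme PK SK Sig) (enc : Encoding ℓ)
    (R : InBlock h → Digest ℓ) (sk : SK) (p : Sim h ℓ Sig α)
    (s : List (List Bool) × List (Bits h)) :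
    (p.interp finderHandler sk).run (finderEnv Ψ enc R) () =
      (p.run (simEnv Ψ enc R sk) s).bind fun y => PMF.pure ((y.1, sk), ()) := by
  refine Prog.run_interp finderHandler (finderEnv Ψ enc R) (simEnv Ψ enc R sk) (fun _ => sk)
    (fun _ => ()) (fun o x => ?_) p s
  cases o with
  | draw =>
    simp only [finderHandler, Prog.run, simEnv, PMF.bind_bind]
    refine congrArg _ (funext fun r => ?_)
    refine Eq.trans ?_ (PMF.pure_bind _ _).symm
    rfl
  | sign m =>
    simp only [finderHandler, Prog.run, simEnv, finderEnv]
    refine (PMF.bind_bind _ _ _).trans (Eq.trans ?_ (PMF.bind_bind _ _ _).symm)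
    refine congrArg _ (funext fun r => ?_)
    refine (PMF.pure_bind _ _).trans (Eq.trans ?_ (PMF.pure_bind _ _).symm)
    rfl
  | _ =>
    simp only [finderHandler, Prog.run, simEnv, finderEnv]
    refine (PMF.pure_bind _ _).trans (Eq.trans ?_ (PMF.pure_bind _ _).symm)
    rfl

/-! ### The forger against the underlying scheme -/

/-- How the forger against `Ψ` makes the calls of the simulation: it samples the random function
lazily and keeps a table of the values sampled. -/
def lazyHandler : (o : SimOp h ℓ) → (InBlock h → Option (Digest ℓ)) →
    Prog (SigForgerOp ℓ) (SigForgerOp.Ans Sig) (o.Ans Sig × (InBlock h → Option (Digest ℓ)))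
  | .ro x, T =>
      match T x with
      | some y => .ret (y, T)
      | none => .coins ℓ fun y => .ret (y, Function.update T x (some y))
  | .add x y, T => .call (.add x y) fun z => .ret (z, T)
  | .sub x y, T => .call (.sub x y) fun z => .ret (z, T)
  | .sign m, T => .call (.sign m) fun g => .ret (g, T)
  | .draw, T => .coins h fun r => .ret (r, T)

/-- The forger against the underlying scheme. -/
def forgeryReduction (h ℓ nmax : ℕ) (PK Sig : Type) :
    Reduction h ℓ PK Sig (SigForgerOp ℓ) (SigForgerOp.Ans Sig) PK (List Bool × Sig) :=
  simReduction nmax lazyHandler (fun pk => .ret (pk, fun _ => none))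
    fun out _ => (message out.2.digest out.1.size, out.2.sig)

theorem plug_forgeryReduction (nmax : ℕ) (F : Forger h ℓ PK Sig) (pk : PK) :
    (forgeryReduction h ℓ nmax PK Sig).plug F pk =
      (((F pk).interp (answer nmax) []).interp lazyHandler fun _ => none).bind fun y =>
        .ret (message y.1.1.2.digest y.1.1.1.size, y.1.1.2.sig) :=
  plug_simReduction ..

/-- The function with the values of a table and of `R` outside of the table. -/
def override {α β : Type} (T : α → Option β) (R : α → β) (x : α) : β := (T x).getD (R x)

theorem override_update {α β : Type} [DecidableEq α] (T : α → Option β) (R : α → β) {x : α}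
    (hx : T x = none) (y : β) :
    override (Function.update T x (some y)) R = override T (Function.update R x y) := by
  funext z
  by_cases hz : z = x
  · subst hz; simp [override, hx]
  · simp [override, Function.update_of_ne hz]

theorem uniform_eq_update {α β : Type} [DecidableEq α] [Fintype α] [Fintype β] [Nonempty β]
    (x : α) : PMF.uniformOfFintype (α → β) = (PMF.uniformOfFintype β).bind fun y =>
      (PMF.uniformOfFintype (α → β)).bind fun R => PMF.pure (Function.update R x y) := by
  classical
  ext Q
  have hinv : Function.Involutive fun z : β × (α → β) => (z.2 x, Function.update z.2 x z.1) := by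
    rintro ⟨y, R⟩
    simp
  simp only [PMF.bind_apply, PMF.uniformOfFintype_apply, tsum_fintype,
    ← Finset.mul_sum]
  have key : ∑ y : β, ∑ R : α → β, (PMF.pure (Function.update R x y) : PMF (α → β)) Q =
      Fintype.card β := by
    rw [← Fintype.sum_prod_type' (f := fun (y : β) (R : α → β) =>
      (PMF.pure (Function.update R x y) : PMF (α → β)) Q)]
    rw [← Equiv.sum_comp hinv.toPerm]
    simp only [Function.Involutive.coe_toPerm, Function.update_idem, Function.update_eq_self]
    rw [Fintype.sum_prod_type]
    have hQ : ∑ R : α → β, (PMF.pure R : PMF (α → β)) Q = 1 :=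
      (Finset.sum_eq_single Q (fun R _ hR => PMF.pure_apply_of_ne _ _ hR.symm) (by simp)).trans
        (PMF.pure_apply_self _)
    simp only [hQ, Finset.sum_const, Finset.card_univ, nsmul_eq_mul, mul_one]
  rw [key, mul_left_comm, ENNReal.inv_mul_cancel (by simp) (by simp), mul_one]

theorem run_interp_lazyHandler {α : Type} (Ψ : SigScheme PK SK Sig) (enc : Encoding ℓ) (sk : SK)
    (p : Sim h ℓ Sig α) (T : InBlock h → Option (Digest ℓ))
    (s : List (List Bool) × List (Bits h)) :
    ((p.interp lazyHandler T).run (sigChallenger Ψ enc sk) s.1).bind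
        (fun y => PMF.pure (y.1.1, y.2)) =
      (PMF.uniformOfFintype (InBlock h → Digest ℓ)).bind fun R =>
        (p.run (simEnv Ψ enc (override T R) sk) s).bind fun y => PMF.pure (y.1, y.2.1) := by
  induction p generalizing T s with
  | ret a => simp [Prog.interp, Prog.run]
  | step c k ih => exact ih T s
  | coins n k ih =>
    simp only [Prog.interp, Prog.run, PMF.bind_bind, ih]
    exact PMF.bind_comm _ _ _
  | call o k ih =>
    cases o with
    | ro x =>
      rcases hx : T x with _ | y
      · simp only [Prog.interp, Prog.run, lazyHandler, hx, Prog.bind, simEnv, PMF.pure_bind,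
          PMF.bind_bind]
        rw [uniform_eq_update x]
        simp only [PMF.bind_bind, PMF.pure_bind]
        refine congrArg _ (funext fun y => ?_)
        refine (ih y _ s).trans (congrArg _ (funext fun R => ?_))
        rw [override_update T R hx]
        have : override T (Function.update R x y) x = y := by simp [override, hx]
        rw [this]
      · simp only [Prog.interp, Prog.run, lazyHandler, hx, Prog.bind, simEnv, PMF.pure_bind]
        refine (ih y T s).trans (congrArg _ (funext fun R => ?_))
        have : override T R x = y := by simp [override, hx]
        rw [this]
    | add x y =>
      simp only [Prog.interp, Prog.run, lazyHandler, Prog.bind, simEnv, sigChallenger,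
        PMF.pure_bind]
      exact ih _ T s
    | sub x y =>
      simp only [Prog.interp, Prog.run, lazyHandler, Prog.bind, simEnv, sigChallenger,
        PMF.pure_bind]
      exact ih _ T s
    | sign m =>
      simp only [Prog.interp, Prog.run, lazyHandler, Prog.bind, simEnv, sigChallenger,
        PMF.pure_bind, PMF.bind_bind]
      refine Eq.trans (congrArg _ (funext fun g => ?_)) (PMF.bind_comm _ _ _)
      exact ih g T (s.1 ++ [m], s.2)
    | draw =>
      simp only [Prog.interp, Prog.run, lazyHandler, Prog.bind, simEnv, PMF.pure_bind,
        PMF.bind_bind]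
      refine Eq.trans (congrArg _ (funext fun r => ?_)) (PMF.bind_comm _ _ _)
      exact ih r T (s.1, s.2 ++ [r])

end Reductions

section Security

variable {h ℓ : ℕ} {PK SK Sig : Type}

/-! ### Forgeries yield collisions or forgeries of the underlying scheme -/

theorem message_left_inj {μ ν : Digest ℓ} {l m : ℕ} (H : message μ l = message ν m) : μ = ν :=
  List.ofFn_injective (List.append_inj_left H (by simp))

theorem findCollision_spec {nmax : ℕ} {enc : Encoding ℓ} {R : InBlock h → Digest ℓ}
    {L : List (Doc h × ISig h ℓ Sig)} {s : List (List Bool) × List (Bits h)}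
    (H : Issued nmax enc R L s) (hB : s.2.Nodup) (out : Doc h × ISig h ℓ Sig)
    (hok : Doc.Ok nmax out.1) (hnew : out.1 ∉ L.map Prod.fst)
    (hdig : out.2.digest = hashH enc R (links out.2.blocks out.1))
    (hlen : out.2.blocks.length = out.1.length + 1)
    (hm : message out.2.digest out.1.size ∈ s.1) :
    (findCollision out L).1.card ≤ nmax ∧ Multiset.card (findCollision out L).2 ≤ nmax ∧
      (findCollision out L).1.val ≠ (findCollision out L).2 ∧
      hashH enc R (findCollision out L).1.val = hashH enc R (findCollision out L).2 := by
  have hex : ∃ x ∈ L, x.2.digest = out.2.digest ∧ (links x.2.blocks x.1).Nodup ∧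
      (links x.2.blocks x.1 : Multiset (InBlock h)) ≠ links out.2.blocks out.1 := by
    rw [H.messages] at hm
    obtain ⟨x, hx, hxm⟩ := List.mem_map.1 hm
    have hnd := (H.nodup hB x hx).1
    refine ⟨x, hx, message_left_inj hxm, nodup_links hnd _, fun heq => hnew ?_⟩
    have hperm := Multiset.coe_eq_coe.1 heq
    have hl := hperm.length_eq
    rw [length_links _ _ (H.length x hx), length_links _ _ hlen] at hl
    rw [← doc_eq_of_links hnd hlen hl fun y hy => hperm.mem_iff.2 hy]
    exact List.mem_map_of_mem hx
  unfold findCollision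
  split
  · rename_i x hx
    have hp := List.find?_some hx
    simp only [decide_eq_true_eq] at hp
    obtain ⟨hd, hnd, hne⟩ := hp
    have hxL := List.mem_of_find?_eq_some hx
    have hval : (links x.2.blocks x.1).toFinset.val = links x.2.blocks x.1 := by
      rw [List.toFinset_val, hnd.dedup]
    refine ⟨(List.toFinset_card_le _).trans ((length_links_le _ _).trans (H.ok x hxL).2),
      (length_links_le _ _).trans hok.2, ?_, ?_⟩
    · rw [hval]; exact hne
    · rw [hval, ← H.digest x hxL, hd, hdig]
  · rename_i hnone
    obtain ⟨x, hx, hp⟩ := hex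
    exact absurd (decide_eq_true hp) (List.find?_eq_none.1 hnone x hx)

/-! ### The games as events of one experiment -/

/-- The random function, the keys, and the simulated execution of a forger. -/
def experiment (nmax : ℕ) (Ψ : SigScheme PK SK Sig) (enc : Encoding ℓ) (F : Forger h ℓ PK Sig) :
    PMF ((InBlock h → Digest ℓ) × (PK × SK) ×
      (((Doc h × ISig h ℓ Sig) × List (Doc h × ISig h ℓ Sig)) ×
        (List (List Bool) × List (Bits h)))) :=
  (PMF.uniformOfFintype (InBlock h → Digest ℓ)).bind fun R =>
    Ψ.gen.bind fun k =>
      (((F k.1).interp (answer nmax) []).run (simEnv Ψ enc R k.2) ([], [])).bind fun y =>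
        PMF.pure (R, k, y)

theorem bind_pure_apply_true {α : Type} (p : PMF α) (b : α → Bool) :
    (p.bind fun a => PMF.pure (b a)) true = p.toOuterMeasure {a | b a = true} := by
  rw [← PMF.toOuterMeasure_apply_singleton]
  exact PMF.toOuterMeasure_map_apply b p {true}

variable (nmax : ℕ) (Ψ : SigScheme PK SK Sig) (enc : Encoding ℓ) (F : Forger h ℓ PK Sig)

theorem forgeGame_eq :
    forgeGame nmax Ψ enc F = (experiment nmax Ψ enc F).bind fun z =>
      PMF.pure (decide (Doc.Ok nmax z.2.2.1.1.1) &&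
        decide (z.2.2.1.1.1 ∉ z.2.2.1.2.map Prod.fst) &&
          decide (z.2.2.1.1.2.digest =
            hashH enc z.1 (links z.2.2.1.1.2.blocks z.2.2.1.1.1)) &&
          incVerify Ψ enc z.1 z.2.1.1 z.2.2.1.1.1 z.2.2.1.1.2) := by
  simp only [forgeGame, experiment, PMF.bind_bind, PMF.pure_bind]
  refine congrArg _ (funext fun R => congrArg _ (funext fun k => ?_))
  have hrun : (F k.1).run (challenger nmax Ψ enc R k.2) [] = _ :=
    Prog.run_eq_run_interp (answer nmax) (simEnv Ψ enc R k.2) (challenger nmax Ψ enc R k.2)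
      (fun L => L) (fun o L s => challenger_eq Ψ enc R k.2 nmax o L s) (F k.1) [] ([], [])
  simp only [hrun, PMF.bind_bind, PMF.pure_bind]

theorem collisionGame_eq :
    collisionGame nmax Ψ enc ((collisionReduction h ℓ nmax PK SK Sig).plug F ()) =
      (experiment nmax Ψ enc F).bind fun z =>
        PMF.pure (decide ((findCollision z.2.2.1.1 z.2.2.1.2).1.card ≤ nmax) &&
          decide (Multiset.card (findCollision z.2.2.1.1 z.2.2.1.2).2 ≤ nmax) &&
          decide ((findCollision z.2.2.1.1 z.2.2.1.2).1.val ≠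
            (findCollision z.2.2.1.1 z.2.2.1.2).2) &&
          decide (hashH enc z.1 (findCollision z.2.2.1.1 z.2.2.1.2).1.val =
            hashH enc z.1 (findCollision z.2.2.1.1 z.2.2.1.2).2)) := by
  simp only [collisionGame, experiment, PMF.bind_bind, PMF.pure_bind, plug_collisionReduction, Prog.run,
    finderEnv, Prog.run_bind]
  refine congrArg _ (funext fun R => congrArg _ (funext fun k => ?_))
  rw [run_interp_finderHandler Ψ enc R k.2 _ ([], [])]
  simp only [PMF.bind_bind, PMF.pure_bind]

theorem sigGame_eq :
    sigGame Ψ enc ((forgeryReduction h ℓ nmax PK Sig).plug F) =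
      (experiment nmax Ψ enc F).bind fun z =>
        PMF.pure (decide (message z.2.2.1.1.2.digest z.2.2.1.1.1.size ∉ z.2.2.2.1) &&
          Ψ.verify z.2.1.1 (message z.2.2.1.1.2.digest z.2.2.1.1.1.size) z.2.2.1.1.2.sig) := by
  simp only [sigGame, experiment, PMF.bind_bind, PMF.pure_bind, plug_forgeryReduction]
  rw [PMF.bind_comm]
  refine congrArg _ (funext fun k => ?_)
  have key := run_interp_lazyHandler Ψ enc k.2 ((F k.1).interp (answer nmax) []) (fun _ => none)
    ([], [])
  have hov : ∀ R : InBlock h → Digest ℓ, override (fun _ => none) R = R := fun R => rfl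
  simp only [hov] at key
  have key' := congrArg (fun p => p.bind fun y => PMF.pure
    (decide (message y.1.1.2.digest y.1.1.1.size ∉ y.2) &&
      Ψ.verify k.1 (message y.1.1.2.digest y.1.1.1.size) y.1.1.2.sig)) key
  simp only [PMF.bind_bind, PMF.pure_bind] at key'
  rw [← key']
  simp only [Prog.run_bind, Prog.run, PMF.bind_bind, PMF.pure_bind]

theorem issued_experiment : ∀ z ∈ (experiment nmax Ψ enc F).support,
    Issued nmax enc z.1 z.2.2.1.2 z.2.2.2 := by
  intro z hz
  obtain ⟨R, -, hz⟩ := (PMF.mem_support_bind_iff _ _ _).1 hz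
  obtain ⟨k, -, hz⟩ := (PMF.mem_support_bind_iff _ _ _).1 hz
  obtain ⟨y, hy, hz⟩ := (PMF.mem_support_bind_iff _ _ _).1 hz
  obtain rfl := (PMF.mem_support_pure_iff _ _).1 hz
  refine Prog.run_interp_invariant (answer nmax) (simEnv Ψ enc R k.2) (Issued nmax enc R)
    (fun o L s hL => issued_answer Ψ enc R k.2 nmax o L s hL) (F k.1) [] ([], []) ?_ y hy
  constructor <;> simp

theorem forgeGame_le (n : ℕ)
    (hn : ∀ pk, ((F pk).interp (answer nmax) []).worst 0 (SimOp.weight 0 0 (fun _ => 0) 1) ≤ n) :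
    forgeGame nmax Ψ enc F true ≤ ((∑ j ∈ Finset.range n, j : ℕ) : ENNReal) * (2 ^ h)⁻¹ +
      collisionGame nmax Ψ enc ((collisionReduction h ℓ nmax PK SK Sig).plug F ()) true +
      sigGame Ψ enc ((forgeryReduction h ℓ nmax PK Sig).plug F) true := by
  rw [forgeGame_eq, collisionGame_eq, sigGame_eq, bind_pure_apply_true, bind_pure_apply_true,
    bind_pure_apply_true]
  have hbad : (experiment nmax Ψ enc F).toOuterMeasure {z | ¬ z.2.2.2.2.Nodup} ≤
      ((∑ j ∈ Finset.range n, j : ℕ) : ENNReal) * (2 ^ h)⁻¹ := by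
    refine toOuterMeasure_bind_le _ _ _ _ fun R => toOuterMeasure_bind_le _ _ _ _ fun k => ?_
    have hb := birthday Ψ enc R k.2 _ n ([], []) (hn k.1) List.nodup_nil
    simp only [List.length_nil, zero_add] at hb
    exact (PMF.toOuterMeasure_map_apply (fun y => (R, k, y)) _ _).trans_le hb
  refine le_trans ?_ (add_le_add_left (add_le_add_left hbad _) _)
  refine le_trans ?_ (add_le_add_left (MeasureTheory.measure_union_le _ _) _)
  refine le_trans ?_ (MeasureTheory.measure_union_le _ _)
  refine PMF.toOuterMeasure_mono _ ?_
  rintro z ⟨hwin, hz⟩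
  have H := issued_experiment nmax Ψ enc F z hz
  simp only [Set.mem_ofPred_eq, Bool.and_eq_true, decide_eq_true_eq, incVerify] at hwin
  obtain ⟨⟨⟨hok, hnew⟩, hdig⟩, hlen, hver⟩ := hwin
  by_cases hB : z.2.2.2.2.Nodup
  · by_cases hm : message z.2.2.1.1.2.digest z.2.2.1.1.1.size ∈ z.2.2.2.1
    · obtain ⟨h1, h2, h3, h4⟩ := findCollision_spec H hB _ hok hnew hdig hlen hm
      refine Or.inl (Or.inr ?_)
      simp only [Set.mem_ofPred_eq, Bool.and_eq_true, decide_eq_true_eq]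
      exact ⟨⟨⟨h1, h2⟩, h3⟩, h4⟩
    · refine Or.inr ?_
      simp only [Set.mem_ofPred_eq, Bool.and_eq_true, decide_eq_true_eq]
      exact ⟨hm, hdig ▸ hver⟩
  · exact Or.inl (Or.inl hB)

/-! ### Costs -/

theorem worst_forger_le {α : Type} (v r s u t qR qs qi : ℕ)
    (p : Prog (ForgerOp h) (ForgerOp.Ans ℓ Sig) α) (ht : p.worst v (fun _ => 0) ≤ t)
    (hR : p.count (ForgerOp.weight 1 0 0) ≤ qR) (hs : p.count (ForgerOp.weight 0 1 0) ≤ qs)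
    (hi : p.count (ForgerOp.weight 0 0 1) ≤ qi) :
    p.worst v (ForgerOp.weight r s u) ≤ (t + r * qR + s * qs + u * qi : ℕ) := by
  have hw : ForgerOp.weight (h := h) r s u = fun o => ((0 + r * ForgerOp.weight 1 0 0 o) +
      s * ForgerOp.weight 0 1 0 o) + u * ForgerOp.weight 0 0 1 o := by
    funext o; cases o <;> simp [ForgerOp.weight]
  have hc : ∀ (c q : ℕ) (w : ForgerOp h → ℕ), p.count w ≤ q →
      p.worst 0 (fun o => c * w o) ≤ (c * q : ℕ) := by
    intro c q w hq
    refine (Prog.worst_mul_le c 0 w p).trans ?_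
    rw [Nat.cast_mul]
    gcongr
    exact hq
  rw [hw]
  push_cast
  refine (Prog.worst_add_le v 0 _ _ p).trans (add_le_add ?_ (by exact_mod_cast hc u qi _ hi))
  refine (Prog.worst_add_le v 0 _ _ p).trans (add_le_add ?_ (by exact_mod_cast hc s qs _ hs))
  exact (Prog.worst_add_le v 0 _ _ p).trans (add_le_add ht (by exact_mod_cast hc r qR _ hR))

theorem worst_interp_answer_le {α : Type} (v r a : ℕ) (g : List Bool → ℕ) (d c t qR qs qi : ℕ)
    (hg : ∀ (μ : Digest ℓ) (l : ℕ), l ≤ nmax * (2 * h) → g (message μ l) ≤ c)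
    (p : Prog (ForgerOp h) (ForgerOp.Ans ℓ Sig) α) (ht : p.worst v (fun _ => 0) ≤ t)
    (hR : p.count (ForgerOp.weight 1 0 0) ≤ qR) (hs : p.count (ForgerOp.weight 0 1 0) ≤ qs)
    (hi : p.count (ForgerOp.weight 0 0 1) ≤ qi) (L : List (Doc h × ISig h ℓ Sig)) :
    (p.interp (answer nmax) L).worst v (SimOp.weight r a g d) ≤
      (t + r * qR + ((nmax + 1) * d + nmax * (r + a) + c) * qs +
        (d + 3 * (r + a) + c) * qi : ℕ) :=
  (Prog.worst_interp_le v _ _ _ (fun o L => worst_answer v r a g d nmax c hg o L) p L).trans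
    (worst_forger_le v _ _ _ t qR qs qi p ht hR hs hi)

theorem worst_zero_zero {Op : Type} {Ans : Op → Type} {α : Type} (p : Prog Op Ans α) :
    p.worst 0 (fun _ => 0) ≤ (0 : ℕ) := by
  simpa using Prog.worst_mul_le 0 0 (fun _ => 0) p

theorem worst_collisionReduction_le (u : ℕ) (w : FinderOp h ℓ SK → ℕ) (c : ℕ∞) (hgen : w .gen = 0)
    (hc : ∀ k : PK × SK, ((F k.1).interp (answer nmax) []).worst u (finderWeight w k.2) ≤ c) :
    ((collisionReduction h ℓ nmax PK SK Sig).plug F ()).worst u w ≤ c := by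
  rw [plug_collisionReduction, Prog.worst, hgen, Nat.cast_zero, zero_add]
  refine iSup_le fun k => ?_
  rw [Prog.worst_bind_ret, worst_interp_finderHandler]
  exact hc k

theorem worst_forgeryReduction_le (u a g : ℕ) (w : SigForgerOp ℓ → ℕ) (c : ℕ∞)
    (hadd : ∀ x y, w (.add x y) = a) (hsub : ∀ x y, w (.sub x y) = a) (hsign : ∀ m, w (.sign m) = g)
    (pk : PK)
    (hc : ((F pk).interp (answer nmax) []).worst u (SimOp.weight 0 a (fun _ => g) 0) ≤ c) :
    ((forgeryReduction h ℓ nmax PK Sig).plug F pk).worst u w ≤ c := by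
  rw [plug_forgeryReduction, Prog.worst_bind_ret]
  refine (Prog.worst_interp_le u _ _ _ (fun o T => ?_) _ _).trans hc
  cases o with
  | ro x =>
    simp only [lazyHandler]
    split <;> simp [Prog.worst]
  | add x y => exact (Prog.worst_call_ret _ _ _ _).trans_le (by rw [hadd]; rfl)
  | sub x y => exact (Prog.worst_call_ret _ _ _ _).trans_le (by rw [hsub]; rfl)
  | sign m => exact (Prog.worst_call_ret _ _ _ _).trans_le (by rw [hsign]; rfl)
  | draw => simp [lazyHandler, Prog.worst]

theorem finderWeight_cost (tOp : ℕ) (sk : SK) :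
    finderWeight (h := h) (ℓ := ℓ) (FinderOp.cost Ψ tOp) sk = SimOp.weight 0 tOp (Ψ.signTime sk) 0 := by
  funext o; cases o <;> rfl

theorem sum_range_div (q h : ℕ) :
    (((∑ j ∈ Finset.range q, j : ℕ) : ENNReal) * (2 ^ h)⁻¹).toReal =
      ((q : ℝ) ^ 2 - q) / 2 ^ (h + 1) := by
  have hs : ((∑ j ∈ Finset.range q, j : ℕ) : ℝ) * 2 = (q : ℝ) ^ 2 - q := by
    induction q with
    | zero => simp
    | succ q ih =>
      rw [Finset.sum_range_succ, Nat.cast_add, add_mul, ih]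
      push_cast
      ring
  rw [← hs, ENNReal.toReal_mul, ENNReal.toReal_inv, ENNReal.toReal_pow]
  simp only [ENNReal.toReal_natCast, ENNReal.toReal_ofNat]
  rw [pow_succ]
  field_simp

theorem exists_reductions (h ℓ nmax : ℕ) (PK SK Sig : Type) :
    ∃ (CF : Reduction h ℓ PK Sig (FinderOp h ℓ SK) (FinderOp.Ans PK Sig) Unit
          (Finset (InBlock h) × Multiset (InBlock h)))
      (F' : Reduction h ℓ PK Sig (SigForgerOp ℓ) (SigForgerOp.Ans Sig) PK (List Bool × Sig)),
      ∀ (Ψ : SigScheme PK SK Sig) (enc : Encoding ℓ) (tSign tOp : ℕ),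
        (∀ (sk : SK) (μ : Digest ℓ) (l : ℕ), l ≤ nmax * (2 * h) →
          Ψ.signTime sk (message μ l) ≤ tSign) →
        ∀ (F : Forger h ℓ PK Sig) (t qR qi qs : ℕ) (ε : ℝ),
          IsForger nmax Ψ enc F t qR qi qs ε →
          ∀ q qh : ℕ, q = qs * (nmax + 1) + qi → qh = qs * nmax + 3 * qi →
            ∃ (t' t'' : ℕ) (ε' ε'' : ℝ),
              IsCollisionFinder nmax Ψ enc tOp (CF.plug F ()) t' (qR + qh) ε' ∧
              IsSigForger Ψ enc tOp (F'.plug F) t'' (qs + qi) ε'' ∧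
              ε ≤ ((q : ℝ) ^ 2 - q) / 2 ^ (h + 1) + ε' + ε'' ∧
              (t : ℝ) ≥ max ((t' : ℝ) - ((qs : ℝ) + qi) * tSign) (t'' : ℝ) - (qh : ℝ) * tOp := by
  refine ⟨collisionReduction h ℓ nmax PK SK Sig,
    forgeryReduction h ℓ nmax PK Sig, ?_⟩
  intro Ψ enc tSign tOp hsign F t qR qi qs ε hF q qh hq hqh
  have hR : ∀ pk, (F pk).count (ForgerOp.weight 1 0 0) ≤ qR := fun pk => by
    refine le_of_eq_of_le (congrArg (fun w => (F pk).count w) ?_) (hF.ro_le pk)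
    funext o; cases o <;> rfl
  have hs : ∀ pk, (F pk).count (ForgerOp.weight 0 1 0) ≤ qs := fun pk => by
    refine le_of_eq_of_le (congrArg (fun w => (F pk).count w) ?_) (hF.sign_le pk)
    funext o; cases o <;> rfl
  have hi : ∀ pk, (F pk).count (ForgerOp.weight 0 0 1) ≤ qi := fun pk => by
    refine le_of_eq_of_le (congrArg (fun w => (F pk).count w) ?_) (hF.update_le pk)
    funext o; cases o <;> rfl
  have ht := hF.time_le
  have cost := fun (v r a : ℕ) (g : List Bool → ℕ) (d c T : ℕ) hg pk hT =>
    worst_interp_answer_le nmax v r a g d c T qR qs qi hg (F pk) hT (hR pk) (hs pk) (hi pk) []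
  refine ⟨t + (qs + qi) * tSign + qh * tOp, t + qh * tOp, _, _,
    ⟨?_, ?_, le_rfl⟩, ⟨fun pk => ?_, fun pk => ?_, le_rfl⟩, ?_, ?_⟩
  · refine worst_collisionReduction_le nmax F 1 _ _ rfl fun k => ?_
    rw [finderWeight_cost]
    refine (cost 1 0 tOp _ 0 tSign t (fun μ l hl => hsign _ μ l hl) k.1 (ht k.1)).trans
      (Nat.cast_le.2 (le_of_eq ?_))
    rw [hqh]; ring
  · refine worst_collisionReduction_le nmax F 0 _ _ rfl fun k => ?_
    refine (Prog.worst_mono 0 (w' := SimOp.weight 1 0 (fun _ => 0) 0)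
      (fun o => ?_) _).trans ?_
    · cases o <;> exact le_rfl
    refine (cost 0 1 0 _ 0 0 0 (fun _ _ _ => le_rfl) k.1 (worst_zero_zero _)).trans
      (Nat.cast_le.2 (le_of_eq ?_))
    rw [hqh]; ring
  · refine worst_forgeryReduction_le nmax F 1 tOp 0 _ _ (fun _ _ => rfl) (fun _ _ => rfl)
      (fun _ => rfl) pk ?_
    refine (cost 1 0 tOp _ 0 0 t (fun _ _ _ => le_rfl) pk (ht pk)).trans
      (Nat.cast_le.2 (le_of_eq ?_))
    rw [hqh]; ring
  · refine worst_forgeryReduction_le nmax F 0 0 1 _ _ (fun _ _ => rfl) (fun _ _ => rfl)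
      (fun _ => rfl) pk ?_
    refine (cost 0 0 0 _ 0 1 0 (fun _ _ _ => le_rfl) pk (worst_zero_zero _)).trans
      (Nat.cast_le.2 (le_of_eq ?_))
    ring
  · refine hF.advantage.trans ?_
    have hle := forgeGame_le nmax Ψ enc F q fun pk =>
      (cost 0 0 0 _ 1 0 0 (fun _ _ _ => le_rfl) pk (worst_zero_zero _)).trans
        (Nat.cast_le.2 (le_of_eq (by rw [hq]; ring)))
    have h1 : ((∑ j ∈ Finset.range q, j : ℕ) : ENNReal) * (2 ^ h)⁻¹ ≠ ⊤ :=
      ENNReal.mul_ne_top (ENNReal.natCast_ne_top _) (by simp)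
    have h2 := PMF.apply_ne_top (collisionGame nmax Ψ enc
      ((collisionReduction h ℓ nmax PK SK Sig).plug F ())) true
    have h3 := PMF.apply_ne_top (sigGame Ψ enc
      ((forgeryReduction h ℓ nmax PK Sig).plug F)) true
    have hle' := ENNReal.toReal_mono (ENNReal.add_ne_top.2 ⟨ENNReal.add_ne_top.2 ⟨h1, h2⟩, h3⟩) hle
    rwa [ENNReal.toReal_add (ENNReal.add_ne_top.2 ⟨h1, h2⟩) h3, ENNReal.toReal_add h1 h2,
      sum_range_div] at hle'
  · push_cast
    rw [ge_iff_le, sub_le_iff_le_add]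
    exact max_le (by linarith) (by linarith)

end Security

end IncSIG

end

theorem theorem1 (h nmax : ℕ) (PK SK Sig : Type) :
    -- The reductions do not depend on the algorithms of `Ψ`, on the representation of residues
    -- modulo `2 ^ 3200`, or on the forger: they use all of these as black boxes.
    ∃ (CF : IncSIG.Reduction h 3200 PK Sig (IncSIG.FinderOp h 3200 SK) (IncSIG.FinderOp.Ans PK Sig) Unit
          (Finset (IncSIG.InBlock h) × Multiset (IncSIG.InBlock h)))
      (F' : IncSIG.Reduction h 3200 PK Sig (IncSIG.SigForgerOp 3200) (IncSIG.SigForgerOp.Ans Sig) PK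
          (List Bool × Sig)),
      ∀ (Ψ : IncSIG.SigScheme PK SK Sig) (enc : IncSIG.Encoding 3200) (tSign tOp : ℕ),
        (∀ (sk : SK) (μ : IncSIG.Digest 3200) (l : ℕ), l ≤ nmax * (2 * h) →
          Ψ.signTime sk (IncSIG.message μ l) ≤ tSign) →
        ∀ (F : IncSIG.Forger h 3200 PK Sig) (t qR qi qs : ℕ) (ε : ℝ),
          IncSIG.IsForger nmax Ψ enc F t qR qi qs ε →
          ∀ q qh : ℕ, q = qs * (nmax + 1) + qi → qh = qs * nmax + 3 * qi →
            ∃ (t' t'' : ℕ) (ε' ε'' : ℝ),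
              IncSIG.IsCollisionFinder nmax Ψ enc tOp (CF.plug F ()) t' (qR + qh) ε' ∧
              IncSIG.IsSigForger Ψ enc tOp (F'.plug F) t'' (qs + qi) ε'' ∧
              ε ≤ ((q : ℝ) ^ 2 - q) / 2 ^ (h + 1) + ε' + ε'' ∧
              (t : ℝ) ≥ max ((t' : ℝ) - ((qs : ℝ) + qi) * tSign) (t'' : ℝ) - (qh : ℝ) * tOp := by
  exact IncSIG.exists_reductions h 3200 nmax PK SK Sig
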